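/- Let $J=\begin{pmatrix}0&1\\-1&0\end{pmatrix}$ and let $Q:\mathbb{R}\to M_2(\mathbb{C})$ be Hermitian and $\pi$-periodic, with entries integrable on $[0,\pi)$ (equivalently, on compact sets). Write $Q=\begin{pmatrix}q_1&q\\ \bar q&q_2\end{pmatrix}$ with $q_1,q_2$ real-valued, and assume that $Q$ is in canonical form, i.e. $Q=Q_1$, where $$Q_1=\operatorname{Re}(q)\begin{pmatrix}0&1\\1&0\end{pmatrix}+\tfrac12(q_1-q_2)\begin{pmatrix}1&0\\0&-1\end{pmatrix}$$ (in other words, $q$ is real-valued and $q_2=-q_1$). For $\lambda\in\mathbb{C}$ let $\mathbb{Y}(\cdot,\lambda):\mathbb{R}\to M_2(\mathbb{C})$ be the matrix solution, with entries absolutely continuous on compact intervals, of $J\mathbb{Y}'+Q\mathbb{Y}=\lambda\mathbb{Y}$ a.e. with $\mathbb{Y}(0,\lambda)=\mathbb{I}$, and let $\Delta(\lambda)=\operatorname{tr}\mathbb{Y}(\pi,\lambda)$ be the discriminant. Then: (a) $Q(z+\frac{\pi}{2})=Q(z)$ for a.e. $z\in\mathbb{R}$ if and only if every zero $\lambda\in\mathbb{C}$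 of $\Delta+2$ has multiplicity exactly $2$; (b) $Q(z+\frac{\pi}{2})=-Q(z)$ for a.e. $z\in\mathbb{R}$ if and only if every zero $\lambda\in\mathbb{C}$ of $\Delta-2$ has multiplicity exactly $2$. -/

import Mathlib

open MeasureTheory

noncomputable section

namespace DiracSystem

/-- The matrix `J` of the differential expression `ℓ Y = J Y' + Q Y`. -/
def J : Matrix (Fin 2) (Fin 2) ℂ := !![0, 1; -1, 0]

/-- The Pauli matrix `σ₁`. -/
def sigma1 : Matrix (Fin 2) (Fin 2) ℂ := !![0, 1; 1, 0]

/-- The Pauli matrix `σ₃`. -/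
def sigma3 : Matrix (Fin 2) (Fin 2) ℂ := !![1, 0; 0, -1]

/-- The component `A₁ = Re(q) σ₁ + ½ (q₁ - q₂) σ₃` of a Hermitian matrix
`A = (q₁, q; q*, q₂)` that anticommutes with `J`. -/
def antiPart (A : Matrix (Fin 2) (Fin 2) ℂ) : Matrix (Fin 2) (Fin 2) ℂ :=
  ((A 0 1).re : ℂ) • sigma1 + ((A 0 0 - A 1 1) / 2) • sigma3

/-- A potential `Q` is in canonical form if `Q = Q₁`. -/
def IsCanonical (Q : ℝ → Matrix (Fin 2) (Fin 2) ℂ) : Prop :=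
  ∀ z, Q z = antiPart (Q z)

/-- The entrywise derivative of a matrix-valued function of a real variable. -/
def entryDeriv (Y : ℝ → Matrix (Fin 2) (Fin 2) ℂ) (z : ℝ) : Matrix (Fin 2) (Fin 2) ℂ :=
  Matrix.of fun i j => deriv (fun t => Y t i j) z

/-- `Y = [Y₁ Y₂]` is the fundamental matrix of `J Y' + Q Y = lam Y` with `Y(0) = 𝕀`: its entries
are absolutely continuous on every compact interval (hence differentiable almost everywhere)
and the equation holds almost everywhere on `ℝ`. -/
structure IsFundamentalMatrix (Q : ℝ → Matrix (Fin 2) (Fin 2) ℂ) (lam : ℂ)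
    (Y : ℝ → Matrix (Fin 2) (Fin 2) ℂ) : Prop where
  absCont : ∀ (i j : Fin 2) (a b : ℝ), AbsolutelyContinuousOnInterval (fun z => Y z i j) a b
  ode : ∀ᵐ z : ℝ, J * entryDeriv Y z + Q z * Y z = lam • Y z
  init : Y 0 = 1

open Classical in
/-- The fundamental matrix `𝕐(z)` of `ℓ Y = lam Y`. When the entries of `Q` are integrable on
compact sets, exactly one function satisfies `IsFundamentalMatrix Q lam` (linear systems with
locally integrable coefficients), and this is that function; the value `0` is used only
if there is no such function. -/
def fundamentalMatrix (Q : ℝ → Matrix (Fin 2) (Fin 2) ℂ) (lam : ℂ) :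
    ℝ → Matrix (Fin 2) (Fin 2) ℂ :=
  if h : ∃ Y, IsFundamentalMatrix Q lam Y then h.choose else 0

/-- The discriminant `Δ(lam) = y₁₁(π) + y₂₂(π)`, the trace of the monodromy matrix. -/
def discriminant (Q : ℝ → Matrix (Fin 2) (Fin 2) ℂ) (lam : ℂ) : ℂ :=
  (fundamentalMatrix Q lam Real.pi).trace

/-- Every zero of `f` in the complex plane has multiplicity exactly two. -/
def HasOnlyDoubleZeros (f : ℂ → ℂ) : Prop :=
  ∀ lam : ℂ, f lam = 0 → analyticOrderAt f lam = 2

end DiracSystem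

end
/-
With `σ = 1` for (a) and `σ = -1` for (b), both claims compare `Q(z + π/2)` with `σ Q(z)` through
the zeros of `Δ + 2σ`, all of which are real: the monodromy matrix of a self-adjoint system has no
eigenvalue of modulus one at a nonreal `λ`. At a real `λ` the derivative of the trace of a real
unimodular gauge of the fundamental matrix is its pairing with a positive definite Gram matrix, so
when the trace lies in `[-2, 2]` the derivative vanishes only at a scalar matrix.

If `Q(z + π/2) = σ Q(z)`, let `R` be `1` for `σ = 1` and `J` for `σ = -1`, and let `N = R Y(π/2)`.
Then `N² = σ Y(π)`, hence `Δ + 2σ = σ (tr N)²`, and the zeros of `tr N` are simple because a scalar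
matrix of trace zero is not unimodular.

Conversely, at a double zero of `Δ + 2σ` the derivative of `Δ` vanishes, so `Y(π) = -σ`. With `T(t)`
the transition matrix over `[t, t + π/2]`, the matrix `T(t + π/2)⁻¹ + σ T(t)` then vanishes at every
zero of `Δ + 2σ`. The product of one of its entries with a fixed scalar combination of its entries
at `t = 0` is therefore divisible by `Δ + 2σ`. The quotient is entire, is `O(1 + |Im λ|⁻²)` off the
real axis, and has a limit as `Im λ → ∞`, so it is constant. At the single value `λ = I` this
determines the comparison matrix for all `t` up to a common factor: a constant multiple of `1` or
`J` carries `Y(·)` to solutions of the shifted system, from which the potential is read off almost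
everywhere.
-/

namespace DiracSystem

open Set Filter Topology intervalIntegral

section ACPrimitive

theorem absolutelyContinuousOnInterval_of_dist_le {X Y : Type*} [PseudoMetricSpace X]
    [PseudoMetricSpace Y] {F : ℝ → X} {G : ℝ → Y} {a b : ℝ} (K : ℝ)
    (hG : AbsolutelyContinuousOnInterval G a b)
    (hFG : ∀ x ∈ uIcc a b, ∀ y ∈ uIcc a b, dist (F x) (F y) ≤ K * dist (G x) (G y)) :
    AbsolutelyContinuousOnInterval F a b := by
  have hlim := Tendsto.const_mul K hG
  rw [mul_zero] at hlim
  refine squeeze_zero' (Eventually.of_forall fun t => Finset.sum_nonneg fun i _ => dist_nonneg)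
    (eventually_inf_principal.2 (Eventually.of_forall fun t ht => ?_)) hlim
  rw [Finset.mul_sum]
  exact Finset.sum_le_sum fun i hi => hFG _ (ht.1 i hi).1 _ (ht.1 i hi).2

variable {E : Type*} [NormedAddCommGroup E] [NormedSpace ℝ E]

/-- `F` is locally absolutely continuous on `ℝ`, with derivative `f` almost everywhere. -/
structure IsACPrimitive (F f : ℝ → E) : Prop where
  ac : ∀ a b, AbsolutelyContinuousOnInterval F a b
  hasDerivAt : ∀ᵐ x, HasDerivAt F (f x) x

namespace IsACPrimitive

variable {F f G g : ℝ → E}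

theorem congr (hF : IsACPrimitive F f) (h : f =ᵐ[volume] g) : IsACPrimitive F g :=
  ⟨hF.ac, by filter_upwards [hF.hasDerivAt, h] with x hx hfx using hfx ▸ hx⟩

theorem continuous (hF : IsACPrimitive F f) : Continuous F := by
  refine continuous_iff_continuousAt.2 fun x =>
    (hF.ac (x - 1) (x + 1)).continuousOn.continuousAt ?_
  rw [uIcc_of_le (by linarith)]
  exact Icc_mem_nhds (by linarith) (by linarith)

theorem of_contDiff (hF : ContDiff ℝ 1 F) : IsACPrimitive F (deriv F) :=
  ⟨fun _ _ => hF.contDiffOn.absolutelyContinuousOnInterval,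
    Eventually.of_forall fun x => (hF.differentiable one_ne_zero x).hasDerivAt⟩

theorem const (c : E) : IsACPrimitive (fun _ => c) (fun _ => 0) := by
  simpa using of_contDiff (F := fun _ => c) contDiff_const

theorem add (hF : IsACPrimitive F f) (hG : IsACPrimitive G g) :
    IsACPrimitive (fun x => F x + G x) (fun x => f x + g x) :=
  ⟨fun a b => (hF.ac a b).add (hG.ac a b), by
    filter_upwards [hF.hasDerivAt, hG.hasDerivAt] with x hx hx' using hx.add hx'⟩

theorem sub (hF : IsACPrimitive F f) (hG : IsACPrimitive G g) :
    IsACPrimitive (fun x => F x - G x) (fun x => f x - g x) :=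
  ⟨fun a b => (hF.ac a b).sub (hG.ac a b), by
    filter_upwards [hF.hasDerivAt, hG.hasDerivAt] with x hx hx' using hx.sub hx'⟩

theorem mul {𝔸 : Type*} [NormedRing 𝔸] [NormMulClass 𝔸] [NormedAlgebra ℝ 𝔸] {F f G g : ℝ → 𝔸}
    (hF : IsACPrimitive F f) (hG : IsACPrimitive G g) :
    IsACPrimitive (fun x => F x * G x) (fun x => f x * G x + F x * g x) :=
  ⟨fun a b => (hF.ac a b).smul (hG.ac a b), by
    filter_upwards [hF.hasDerivAt, hG.hasDerivAt] with x hx hx' using hx.mul hx'⟩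

theorem const_mul {𝔸 : Type*} [NormedRing 𝔸] [NormMulClass 𝔸] [NormedAlgebra ℝ 𝔸] {F f : ℝ → 𝔸}
    (c : 𝔸) (hF : IsACPrimitive F f) : IsACPrimitive (fun x => c * F x) (fun x => c * f x) := by
  simpa only [zero_mul, zero_add] using (const c).mul hF

theorem clm_comp {E' : Type*} [NormedAddCommGroup E'] [NormedSpace ℝ E'] (L : E →L[ℝ] E')
    (hF : IsACPrimitive F f) : IsACPrimitive (fun x => L (F x)) (fun x => L (f x)) :=
  ⟨fun a b => absolutelyContinuousOnInterval_of_dist_le ‖L‖ (hF.ac a b)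
    fun x _ y _ => L.dist_le_opNorm (F x) (F y), by
    filter_upwards [hF.hasDerivAt] with x hx using L.hasFDerivAt.comp_hasDerivAt x hx⟩

theorem contDiff_comp {φ : ℝ → E} (hφ : ContDiff ℝ 1 φ) {F f : ℝ → ℝ} (hF : IsACPrimitive F f) :
    IsACPrimitive (fun x => φ (F x)) (fun x => f x • deriv φ (F x)) := by
  refine ⟨fun a b => ?_, ?_⟩
  · obtain ⟨C, hC⟩ := (hF.ac a b).exists_bound
    obtain ⟨K, hK⟩ := hφ.contDiffOn.exists_lipschitzOnWith one_ne_zero (convex_Icc (-C) C)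
      isCompact_Icc
    exact absolutelyContinuousOnInterval_of_dist_le K (hF.ac a b) fun x hx y hy =>
      hK.dist_le_mul _ (abs_le.1 (hC x hx)) _ (abs_le.1 (hC y hy))
  · filter_upwards [hF.hasDerivAt] with x hx using
      (hφ.differentiable one_ne_zero (F x)).hasDerivAt.scomp x hx

theorem exp {F f : ℝ → ℝ} (hF : IsACPrimitive F f) :
    IsACPrimitive (fun x => Real.exp (F x)) (fun x => f x * Real.exp (F x)) := by
  simpa only [Real.deriv_exp, smul_eq_mul] using hF.contDiff_comp Real.contDiff_exp

theorem im {F f : ℝ → ℂ} (hF : IsACPrimitive F f) :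
    IsACPrimitive (fun x => (F x).im) (fun x => (f x).im) := hF.clm_comp Complex.imCLM

theorem conj {F f : ℝ → ℂ} (hF : IsACPrimitive F f) :
    IsACPrimitive (fun x => (starRingEnd ℂ) (F x)) (fun x => (starRingEnd ℂ) (f x)) :=
  hF.clm_comp (Complex.conjCLE : ℂ →L[ℝ] ℂ)

theorem eq_of_zero (hF : IsACPrimitive F (fun _ => 0)) (x y : ℝ) : F x = F y := by
  obtain ⟨C, hC⟩ := (hF.ac x y).const_of_ae_hasDerivAt_zero
    (by filter_upwards [hF.hasDerivAt] with z hz _ using hz)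
  rw [hC x left_mem_uIcc, hC y right_mem_uIcc]

theorem of_absolutelyContinuous [FiniteDimensional ℝ E]
    (hF : ∀ a b, AbsolutelyContinuousOnInterval F a b) : IsACPrimitive F (deriv F) := by
  have hdiff : ∀ᵐ x : ℝ, ∀ n : ℕ, x ∈ uIcc (-n : ℝ) n → DifferentiableAt ℝ F x :=
    ae_all_iff.2 fun n => (hF (-n) n).boundedVariationOn.ae_differentiableAt_of_mem_uIcc
  refine ⟨hF, ?_⟩
  filter_upwards [hdiff] with x hx
  obtain ⟨n, hn⟩ := exists_nat_ge |x|
  exact (hx n (by rw [uIcc_of_le (by simp)]; exact abs_le.1 hn)).hasDerivAt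

theorem of_intervalIntegrable [CompleteSpace E]
    (hf : ∀ a b, IntervalIntegrable f volume a b) (c : ℝ) :
    IsACPrimitive (fun x => ∫ t in c..x, f t) f := by
  refine ⟨fun a b => ?_, ?_⟩
  · refine absolutelyContinuousOnInterval_of_dist_le 1
      ((hf a b).norm.absolutelyContinuousOnInterval_intervalIntegral left_mem_uIcc)
      fun x _ y _ => ?_
    rw [dist_comm, dist_comm (∫ t in a..x, ‖f t‖), dist_eq_norm, Real.dist_eq, one_mul,
      integral_interval_sub_left (hf c y) (hf c x),
      integral_interval_sub_left (hf a y).norm (hf a x).norm]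
    exact norm_integral_le_abs_integral_norm
  · have hloc : LocallyIntegrable f := fun x => ⟨Ioc (x - 1) (x + 1),
      Ioc_mem_nhds (by linarith) (by linarith), (hf (x - 1) (x + 1)).1⟩
    filter_upwards [LocallyIntegrable.ae_hasDerivAt_integral hloc] with x hx using hx c

section RCLike

variable {𝕜 : Type*} [RCLike 𝕜] {F f : ℝ → 𝕜}

theorem intervalIntegrable (hF : IsACPrimitive F f) (a b : ℝ) :
    IntervalIntegrable f volume a b := by
  have real {G g : ℝ → ℝ} (hG : IsACPrimitive G g) : IntervalIntegrable g volume a b := by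
    refine (hG.ac a b).intervalIntegrable_deriv.congr_ae ?_
    filter_upwards [ae_restrict_of_ae hG.hasDerivAt] with x hx using hx.deriv
  have hre := real (hF.clm_comp RCLike.reCLM)
  have him := real (hF.clm_comp RCLike.imCLM)
  exact ⟨Integrable.re_im_iff.1 ⟨hre.1, him.1⟩, Integrable.re_im_iff.1 ⟨hre.2, him.2⟩⟩

theorem integral_eq_sub (hF : IsACPrimitive F f) (a b : ℝ) : ∫ x in a..b, f x = F b - F a := by
  have hdiff : IsACPrimitive (fun x => F x - ∫ t in a..x, f t) (fun _ => 0) := by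
    simpa only [sub_self] using hF.sub (of_intervalIntegrable hF.intervalIntegrable a)
  have := hdiff.eq_of_zero a b
  rw [integral_same, sub_zero] at this
  rw [this, sub_sub_cancel]

theorem comp_add_right (hF : IsACPrimitive F f) (c : ℝ) :
    IsACPrimitive (fun x => F (x + c)) (fun x => f (x + c)) := by
  have hf a b : IntervalIntegrable (fun x => f (x + c)) volume a b := by
    simpa only [add_sub_cancel_right] using
      (hF.intervalIntegrable (a + c) (b + c)).comp_add_right c
  have hprim := (const (F c)).add (of_intervalIntegrable hf 0)
  simpa only [integral_comp_add_right, hF.integral_eq_sub, zero_add, add_sub_cancel] using hprim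

end RCLike

theorem le_of_nonpos {F f : ℝ → ℝ} (hF : IsACPrimitive F f) {a b : ℝ} (hab : a ≤ b)
    (hf : ∀ᵐ x, x ∈ Ioc a b → f x ≤ 0) : F b ≤ F a := by
  have hint : ∫ x in a..b, f x ≤ 0 := by
    rw [integral_of_le hab]
    exact setIntegral_nonpos_ae measurableSet_Ioc hf
  rwa [hF.integral_eq_sub, sub_nonpos] at hint

end IsACPrimitive

end ACPrimitive

section Volterra

theorem le_mul_exp_of_le_integral {u k : ℝ → ℝ} {c L : ℝ} (hu : Continuous u)
    (hk : ∀ a b, IntervalIntegrable k volume a b) (hk_nonneg : ∀ x, 0 ≤ k x)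
    (h : ∀ z ∈ Icc 0 L, u z ≤ c + ∫ x in (0 : ℝ)..z, k x * u x) {z : ℝ} (hz : z ∈ Icc 0 L) :
    u z ≤ c * Real.exp (∫ x in (0 : ℝ)..z, k x) := by
  have hku a b : IntervalIntegrable (fun x => k x * u x) volume a b :=
    (hk a b).mul_continuousOn hu.continuousOn
  have hprod := ((IsACPrimitive.const c).add (.of_intervalIntegrable hku 0)).mul
    ((IsACPrimitive.of_intervalIntegrable hk 0).const_mul (-1)).exp
  have hdecr := hprod.le_of_nonpos hz.1 (Eventually.of_forall fun x hx => by
    have hmul := mul_le_mul_of_nonneg_right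
      (mul_le_mul_of_nonneg_left (h x ⟨hx.1.le, hx.2.trans hz.2⟩) (hk_nonneg x))
      (Real.exp_pos (-1 * ∫ t in (0 : ℝ)..x, k t)).le
    linarith)
  simp only [integral_same, add_zero, mul_zero, Real.exp_zero, mul_one, neg_mul, one_mul,
    Real.exp_neg] at hdecr
  rw [← div_eq_mul_inv, div_le_iff₀ (Real.exp_pos _)] at hdecr
  exact (h z hz).trans hdecr

theorem abs_integral_mul_cosh_le {k : ℝ → ℝ} (hk : ∀ a b, IntervalIntegrable k volume a b)
    (z : ℝ) :
    |∫ x in (0 : ℝ)..z, k x * Real.cosh (2 * ∫ t in (0 : ℝ)..x, k t)| ≤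
      Real.cosh (2 * ∫ t in (0 : ℝ)..z, k t) / 2 := by
  have hprim := ((IsACPrimitive.of_intervalIntegrable hk 0).const_mul 2).contDiff_comp
    (φ := fun s => Real.sinh s / 2) (by fun_prop)
  have hint := hprim.integral_eq_sub 0 z
  simp only [deriv_div_const, Real.deriv_sinh, smul_eq_mul, integral_same, mul_zero,
    Real.sinh_zero, zero_div, sub_zero] at hint
  rw [integral_congr (g := fun x => 2 * k x * (Real.cosh (2 * ∫ t in (0 : ℝ)..x, k t) / 2))
    fun x _ => by ring, hint, abs_div, Nat.abs_ofNat, Real.abs_sinh, ← Real.cosh_abs]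
  gcongr
  exact (Real.sinh_lt_cosh _).le

open scoped BoundedContinuousFunction

variable {𝔸 : Type*} [NormedRing 𝔸] {K : ℝ → 𝔸}

/-- The weight with respect to which the Volterra operator `Y ↦ ∫₀ᶻ K Y` halves norms. A hyperbolic
cosine serves both signs of `z` at once. -/
noncomputable def volterraWeight (K : ℝ → 𝔸) (z : ℝ) : ℝ :=
  Real.cosh (2 * ∫ t in (0 : ℝ)..z, ‖K t‖)

theorem volterraWeight_pos (K : ℝ → 𝔸) (z : ℝ) : 0 < volterraWeight K z := Real.cosh_pos _

theorem one_le_volterraWeight (K : ℝ → 𝔸) (z : ℝ) : 1 ≤ volterraWeight K z := Real.one_le_cosh _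

theorem continuous_volterraWeight (hK : ∀ a b, IntervalIntegrable K volume a b) :
    Continuous (volterraWeight K) :=
  Real.continuous_cosh.comp (continuous_const.mul
    (IsACPrimitive.of_intervalIntegrable (fun a b => (hK a b).norm) 0).continuous)

variable [NormedAlgebra ℝ 𝔸]

theorem norm_integral_mul_le_volterraWeight (hK : ∀ a b, IntervalIntegrable K volume a b)
    {u : ℝ → 𝔸} {C : ℝ} (hu : ∀ s, ‖u s‖ ≤ C * volterraWeight K s) (z : ℝ) :
    ‖∫ s in (0 : ℝ)..z, K s * u s‖ ≤ C * (volterraWeight K z / 2) := by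
  have hk a b : IntervalIntegrable (fun s => ‖K s‖) volume a b := (hK a b).norm
  have hC : 0 ≤ C :=
    nonneg_of_mul_nonneg_left ((norm_nonneg _).trans (hu 0)) (volterraWeight_pos K 0)
  calc ‖∫ s in (0 : ℝ)..z, K s * u s‖
      ≤ |∫ s in (0 : ℝ)..z, C * (‖K s‖ * volterraWeight K s)| := by
        refine norm_integral_le_abs_of_norm_le (Eventually.of_forall fun s => ?_)
          (((hk 0 z).mul_continuousOn (continuous_volterraWeight hK).continuousOn).const_mul C)
        calc ‖K s * u s‖ ≤ ‖K s‖ * (C * volterraWeight K s) :=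
              (norm_mul_le _ _).trans (by gcongr; exact hu s)
          _ = C * (‖K s‖ * volterraWeight K s) := by ring
    _ = C * |∫ s in (0 : ℝ)..z, ‖K s‖ * volterraWeight K s| := by
        rw [intervalIntegral.integral_const_mul, abs_mul, abs_of_nonneg hC]
    _ ≤ C * (volterraWeight K z / 2) :=
        mul_le_mul_of_nonneg_left (abs_integral_mul_cosh_le hk z) hC

theorem norm_volterraWeight_smul_le (K : ℝ → 𝔸) {v : ℝ → 𝔸} {C : ℝ} {z : ℝ} (hv : ‖v z‖ ≤ C) :
    ‖volterraWeight K z • v z‖ ≤ C * volterraWeight K z := by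
  rw [norm_smul, Real.norm_of_nonneg (volterraWeight_pos K z).le, mul_comm]
  exact mul_le_mul_of_nonneg_right hv (volterraWeight_pos K z).le

theorem norm_inv_volterraWeight_smul_le_iff (K : ℝ → 𝔸) {x : 𝔸} {C : ℝ} {z : ℝ} :
    ‖(volterraWeight K z)⁻¹ • x‖ ≤ C ↔ ‖x‖ ≤ volterraWeight K z * C := by
  have hw := volterraWeight_pos K z
  rw [norm_smul, norm_inv, Real.norm_of_nonneg hw.le, inv_mul_le_iff₀ hw]

theorem intervalIntegrable_mul_volterraWeight_smul (hK : ∀ a b, IntervalIntegrable K volume a b)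
    {v : ℝ → 𝔸} (hv : Continuous v) (a b : ℝ) :
    IntervalIntegrable (fun s => K s * (volterraWeight K s • v s)) volume a b :=
  (hK a b).mul_continuousOn ((continuous_volterraWeight hK).smul hv).continuousOn

variable [CompleteSpace 𝔸]

/-- The Picard iteration for `Y z = y + ∫₀ᶻ K Y`, in the unknown `v = Y / volterraWeight K`. -/
noncomputable def volterraMap (hK : ∀ a b, IntervalIntegrable K volume a b) (y : 𝔸)
    (v : ℝ →ᵇ 𝔸) : ℝ →ᵇ 𝔸 :=
  .ofNormedAddCommGroup
    (fun z => (volterraWeight K z)⁻¹ •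
      (y + ∫ s in (0 : ℝ)..z, K s * (volterraWeight K s • v s)))
    (((continuous_volterraWeight hK).inv₀ fun z => (volterraWeight_pos K z).ne').smul
      (continuous_const.add (IsACPrimitive.of_intervalIntegrable
        (intervalIntegrable_mul_volterraWeight_smul hK v.continuous) 0).continuous))
    (‖y‖ + ‖v‖) fun z => by
      rw [norm_inv_volterraWeight_smul_le_iff]
      have hint := norm_integral_mul_le_volterraWeight hK
        (fun s => norm_volterraWeight_smul_le K (v.norm_coe_le_norm s)) z
      have hy := mul_le_mul_of_nonneg_right (one_le_volterraWeight K z) (norm_nonneg y)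
      have hv := mul_nonneg (norm_nonneg v) (volterraWeight_pos K z).le
      linarith [norm_add_le y (∫ s in (0 : ℝ)..z, K s * (volterraWeight K s • v s))]

theorem contractingWith_volterraMap (hK : ∀ a b, IntervalIntegrable K volume a b) (y : 𝔸) :
    ContractingWith (1 / 2) (volterraMap hK y) := by
  refine ⟨by rw [← NNReal.coe_lt_coe]; norm_num, LipschitzWith.of_dist_le_mul fun v v' => ?_⟩
  refine (BoundedContinuousFunction.dist_le (by positivity)).2 fun z => ?_
  have hsub : volterraMap hK y v z - volterraMap hK y v' z = (volterraWeight K z)⁻¹ •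
      ∫ s in (0 : ℝ)..z, K s * (volterraWeight K s • (v s - v' s)) := by
    simp only [volterraMap, BoundedContinuousFunction.coe_ofNormedAddCommGroup]
    rw [← smul_sub, add_sub_add_left_eq_sub, ← intervalIntegral.integral_sub
      (intervalIntegrable_mul_volterraWeight_smul hK v.continuous 0 z)
      (intervalIntegrable_mul_volterraWeight_smul hK v'.continuous 0 z)]
    simp only [← mul_sub, ← smul_sub]
  rw [dist_eq_norm, hsub, norm_inv_volterraWeight_smul_le_iff]
  refine (norm_integral_mul_le_volterraWeight hK (C := dist v v')
    (fun s => norm_volterraWeight_smul_le K (v := fun s => v s - v' s) ?_) z).trans_eq ?_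
  · rw [← dist_eq_norm]
    exact BoundedContinuousFunction.dist_coe_le_dist s
  · push_cast
    ring

theorem exists_volterra_solution (hK : ∀ a b, IntervalIntegrable K volume a b) (y : 𝔸) :
    ∃ Y : ℝ → 𝔸, Continuous Y ∧ ∀ z, Y z = y + ∫ s in (0 : ℝ)..z, K s * Y s := by
  obtain ⟨v, hv⟩ : ∃ v, volterraMap hK y v = v :=
    ⟨_, (contractingWith_volterraMap hK y).fixedPoint_isFixedPt⟩
  refine ⟨fun z => volterraWeight K z • v z, (continuous_volterraWeight hK).smul v.continuous,
    fun z => ?_⟩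
  conv_lhs => rw [← hv]
  simp only [volterraMap, BoundedContinuousFunction.coe_ofNormedAddCommGroup,
    smul_inv_smul₀ (volterraWeight_pos K z).ne']

end Volterra

section System

open Matrix

variable {p q p' q' : ℝ → ℝ} {l m : ℂ} {u v u' v' : ℝ → ℂ} {Y : ℝ → Matrix (Fin 2) (Fin 2) ℂ}

/-- `(u, v)` solves `J y' + Q y = l y` almost everywhere, where `Q = (p, q; q, -p)`. -/
structure IsSolution (p q : ℝ → ℝ) (l : ℂ) (u v : ℝ → ℂ) : Prop where
  fst : IsACPrimitive u fun z => q z * u z - (p z + l) * v z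
  snd : IsACPrimitive v fun z => (l - p z) * u z - q z * v z

/-- The columns of `Y` solve `J y' + Q y = l y`, where `Q = (p, q; q, -p)`. -/
def IsMatrixSolution (p q : ℝ → ℝ) (l : ℂ) (Y : ℝ → Matrix (Fin 2) (Fin 2) ℂ) : Prop :=
  ∀ j, IsSolution p q l (fun z => Y z 0 j) (fun z => Y z 1 j)

/-- The potential `Q = (p, q; q, -p)`; real `p` and `q` give all potentials that are both Hermitian
and canonical. -/
def canonicalPotential (p q : ℝ → ℝ) (z : ℝ) : Matrix (Fin 2) (Fin 2) ℂ :=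
  !![(p z : ℂ), q z; q z, -p z]

/-- The fundamental matrix of the system with potential `(p, q; q, -p)`. -/
noncomputable abbrev fundMat (p q : ℝ → ℝ) (l : ℂ) (z : ℝ) : Matrix (Fin 2) (Fin 2) ℂ :=
  fundamentalMatrix (canonicalPotential p q) l z

/-- The potential `(p, q; q, -p)` is integrable on compact intervals. -/
structure LocallyIntegrableEntries (p q : ℝ → ℝ) : Prop where
  left : ∀ a b, IntervalIntegrable p volume a b
  right : ∀ a b, IntervalIntegrable q volume a b

namespace IsSolution

theorem linear_comb (h : IsSolution p q l u v) (h' : IsSolution p q l u' v') (a b : ℂ) :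
    IsSolution p q l (fun z => a * u z + b * u' z) (fun z => a * v z + b * v' z) :=
  ⟨((h.fst.const_mul a).add (h'.fst.const_mul b)).congr (Eventually.of_forall fun z => by ring),
    ((h.snd.const_mul a).add (h'.snd.const_mul b)).congr (Eventually.of_forall fun z => by ring)⟩

theorem conj (h : IsSolution p q l u v) :
    IsSolution p q (starRingEnd ℂ l) (fun z => starRingEnd ℂ (u z))
      (fun z => starRingEnd ℂ (v z)) :=
  ⟨h.fst.conj.congr (Eventually.of_forall fun z => by simp),
    h.snd.conj.congr (Eventually.of_forall fun z => by simp)⟩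

theorem shift (h : IsSolution p q l u v) (t : ℝ) :
    IsSolution (fun z => p (z + t)) (fun z => q (z + t)) l (fun z => u (z + t))
      (fun z => v (z + t)) :=
  ⟨h.fst.comp_add_right t, h.snd.comp_add_right t⟩

theorem congr_potential (h : IsSolution p q l u v) (hp : p =ᵐ[volume] p') (hq : q =ᵐ[volume] q') :
    IsSolution p' q' l u v :=
  ⟨h.fst.congr (by filter_upwards [hp, hq] with z hpz hqz; rw [hpz, hqz]),
    h.snd.congr (by filter_upwards [hp, hq] with z hpz hqz; rw [hpz, hqz])⟩

theorem rotate (h : IsSolution p q l u v) {σ : ℝ} {α β : ℂ} (hα : σ * α = α) (hβ : σ * β = -β) :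
    IsSolution (fun z => σ * p z) (fun z => σ * q z) l (fun z => α * u z + β * v z)
      (fun z => -β * u z + α * v z) := by
  refine ⟨((h.fst.const_mul α).add (h.snd.const_mul β)).congr (Eventually.of_forall fun z => ?_),
    ((h.fst.const_mul (-β)).add (h.snd.const_mul α)).congr (Eventually.of_forall fun z => ?_)⟩
  · push_cast
    linear_combination (-q z * u z + p z * v z) * hα + (-q z * v z - p z * u z) * hβ
  · push_cast
    linear_combination (p z * u z + q z * v z) * hα + (-q z * u z + p z * v z) * hβ

theorem lagrange (h : IsSolution p q l u v) (h' : IsSolution p q m u' v') :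
    IsACPrimitive (fun z => u z * v' z - v z * u' z)
      (fun z => (m - l) * (u z * u' z + v z * v' z)) :=
  ((h.fst.mul h'.snd).sub (h.snd.mul h'.fst)).congr (Eventually.of_forall fun z => by
    dsimp only
    ring)

theorem wronskian_eq (h : IsSolution p q l u v) (h' : IsSolution p q l u' v') (z : ℝ) :
    u z * v' z - v z * u' z = u 0 * v' 0 - v 0 * u' 0 :=
  ((h.lagrange h').congr (g := fun _ => 0) (by simp)).eq_of_zero z 0

theorem energy (h : IsSolution p q l u v) :
    IsACPrimitive (fun z => (starRingEnd ℂ (u z) * v z).im)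
      (fun z => l.im * (‖u z‖ ^ 2 + ‖v z‖ ^ 2)) := by
  have hlagrange := (h.conj.lagrange h).im.const_mul (1 / 2)
  have him : (fun z => 1 / 2 * (starRingEnd ℂ (u z) * v z - starRingEnd ℂ (v z) * u z).im) =
      fun z => (starRingEnd ℂ (u z) * v z).im := by
    funext z
    simp only [Complex.sub_im, Complex.mul_im, Complex.conj_re, Complex.conj_im]
    ring
  rw [him] at hlagrange
  refine hlagrange.congr (Eventually.of_forall fun z => ?_)
  simp only [Complex.sq_norm, Complex.normSq_apply, Complex.mul_im, Complex.mul_re, Complex.add_re,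
    Complex.add_im, Complex.sub_re, Complex.sub_im, Complex.conj_re, Complex.conj_im]
  ring

end IsSolution

namespace IsMatrixSolution

theorem mul_const (hY : IsMatrixSolution p q l Y) (M : Matrix (Fin 2) (Fin 2) ℂ) :
    IsMatrixSolution p q l (fun z => Y z * M) := fun j => by
  simpa only [mul_apply, Fin.sum_univ_two, mul_comm (M _ _)] using
    (hY 0).linear_comb (hY 1) (M 0 j) (M 1 j)

theorem shift (hY : IsMatrixSolution p q l Y) (t : ℝ) :
    IsMatrixSolution (fun z => p (z + t)) (fun z => q (z + t)) l (fun z => Y (z + t)) :=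
  fun j => (hY j).shift t

theorem conj (hY : IsMatrixSolution p q l Y) :
    IsMatrixSolution p q (starRingEnd ℂ l) (fun z => (Y z).map (starRingEnd ℂ)) :=
  fun j => (hY j).conj

theorem congr_potential (hY : IsMatrixSolution p q l Y) (hp : p =ᵐ[volume] p')
    (hq : q =ᵐ[volume] q') : IsMatrixSolution p' q' l Y :=
  fun j => (hY j).congr_potential hp hq

theorem rotate (hY : IsMatrixSolution p q l Y) {σ : ℝ} {α β : ℂ} (hα : σ * α = α)
    (hβ : σ * β = -β) :
    IsMatrixSolution (fun z => σ * p z) (fun z => σ * q z) l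
      (fun z => !![α, β; -β, α] * Y z) := fun j => by
  simpa [mul_apply, Fin.sum_univ_two] using (hY j).rotate hα hβ

theorem det_eq (hY : IsMatrixSolution p q l Y) (z : ℝ) : (Y z).det = (Y 0).det := by
  rw [det_fin_two, det_fin_two]
  linear_combination (hY 0).wronskian_eq (hY 1) z

theorem potential_ae_eq (hY : IsMatrixSolution p q l Y) (hY' : IsMatrixSolution p' q' l Y)
    (hdet : ∀ z, (Y z).det ≠ 0) : ∀ᵐ z, p z = p' z ∧ q z = q' z := by
  filter_upwards [(hY 0).fst.hasDerivAt, (hY' 0).fst.hasDerivAt, (hY 1).fst.hasDerivAt,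
    (hY' 1).fst.hasDerivAt] with z h₀ h₀' h₁ h₁'
  have eq₀ := h₀.unique h₀'
  have eq₁ := h₁.unique h₁'
  have hdet := hdet z
  rw [det_fin_two] at hdet
  constructor <;> refine Complex.ofReal_injective (mul_right_cancel₀ hdet ?_)
  · linear_combination Y z 0 1 * eq₀ - Y z 0 0 * eq₁
  · linear_combination Y z 1 1 * eq₀ - Y z 1 0 * eq₁

end IsMatrixSolution

theorem canonical_equation_iff {D A : Matrix (Fin 2) (Fin 2) ℂ} {z : ℝ} :
    J * D + canonicalPotential p q z * A = l • A ↔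
      ∀ j, D 0 j = q z * A 0 j - (p z + l) * A 1 j ∧ D 1 j = (l - p z) * A 0 j - q z * A 1 j := by
  rw [← Matrix.ext_iff, Fin.forall_fin_two, ← forall_and]
  refine forall_congr' fun j => ?_
  simp only [J, canonicalPotential, Matrix.add_apply, mul_apply, Fin.sum_univ_two,
    Matrix.smul_apply, smul_eq_mul, cons_val', of_apply, cons_val_zero, cons_val_one,
    cons_val_fin_one]
  grind

theorem isFundamentalMatrix_iff :
    IsFundamentalMatrix (canonicalPotential p q) l Y ↔ IsMatrixSolution p q l Y ∧ Y 0 = 1 := by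
  constructor
  · intro h
    have hderiv j : ∀ᵐ z, deriv (fun t => Y t 0 j) z = q z * Y z 0 j - (p z + l) * Y z 1 j ∧
        deriv (fun t => Y t 1 j) z = (l - p z) * Y z 0 j - q z * Y z 1 j := by
      filter_upwards [h.ode] with z hz using canonical_equation_iff.1 hz j
    exact ⟨fun j =>
      ⟨(IsACPrimitive.of_absolutelyContinuous (h.absCont 0 j)).congr
          ((hderiv j).mono fun _ => And.left),
        (IsACPrimitive.of_absolutelyContinuous (h.absCont 1 j)).congr
          ((hderiv j).mono fun _ => And.right)⟩, h.init⟩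
  · rintro ⟨h, h0⟩
    refine ⟨Fin.forall_fin_two.2 ⟨fun j => (h j).fst.ac, fun j => (h j).snd.ac⟩, ?_, h0⟩
    filter_upwards [(h 0).fst.hasDerivAt, (h 1).fst.hasDerivAt, (h 0).snd.hasDerivAt,
      (h 1).snd.hasDerivAt] with z h₀₀ h₀₁ h₁₀ h₁₁
    exact canonical_equation_iff.2
      (Fin.forall_fin_two.2 ⟨⟨h₀₀.deriv, h₁₀.deriv⟩, ⟨h₀₁.deriv, h₁₁.deriv⟩⟩)

namespace LocallyIntegrableEntries

variable (h : LocallyIntegrableEntries p q)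
include h

theorem shift (t : ℝ) : LocallyIntegrableEntries (fun z => p (z + t)) (fun z => q (z + t)) :=
  ⟨fun a b => by simpa using (h.left (a + t) (b + t)).comp_add_right t,
    fun a b => by simpa using (h.right (a + t) (b + t)).comp_add_right t⟩

theorem exists_isMatrixSolution (l : ℂ) :
    ∃ Y : ℝ → Matrix (Fin 2) (Fin 2) ℂ, IsMatrixSolution p q l Y ∧ Y 0 = 1 := by
  let toEnd (M : Matrix (Fin 2) (Fin 2) ℂ) : (Fin 2 → ℂ) →L[ℝ] (Fin 2 → ℂ) :=
    (M.mulVecLin.restrictScalars ℝ).toContinuousLinearMap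
  let K (s : ℝ) := q s • toEnd !![1, 0; 0, -1] + p s • toEnd !![0, -1; -1, 0] +
    toEnd !![0, -l; l, 0]
  have hsmul {f : ℝ → ℝ} (hf : ∀ a b, IntervalIntegrable f volume a b)
      (A : (Fin 2 → ℂ) →L[ℝ] (Fin 2 → ℂ)) (a b : ℝ) :
      IntervalIntegrable (fun s => f s • A) volume a b :=
    ⟨(hf a b).1.smul_const A, (hf a b).2.smul_const A⟩
  have hK a b : IntervalIntegrable K volume a b :=
    ((hsmul h.right _ a b).add (hsmul h.left _ a b)).add intervalIntegrable_const
  obtain ⟨Y, hYcont, hY⟩ := exists_volterra_solution hK 1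
  have hprim : IsACPrimitive Y fun z => K z * Y z := by
    have hY' := (IsACPrimitive.const (1 : (Fin 2 → ℂ) →L[ℝ] (Fin 2 → ℂ))).add
      (.of_intervalIntegrable (fun a b => (hK a b).mul_continuousOn hYcont.continuousOn) 0)
    simpa only [zero_add, ← hY] using hY'
  have hentry (i j : Fin 2) := hprim.clm_comp
    (ContinuousLinearMap.proj (R := ℝ) i ∘L ContinuousLinearMap.apply ℝ (Fin 2 → ℂ) (Pi.single j 1))
  refine ⟨fun z => of fun i j => Y z (Pi.single j 1) i,
    fun j => ⟨(hentry 0 j).congr ?_, (hentry 1 j).congr ?_⟩, ?_⟩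
  · refine Eventually.of_forall fun z => ?_
    simp [K, toEnd, dotProduct, Fin.sum_univ_two]
    ring
  · refine Eventually.of_forall fun z => ?_
    simp [K, toEnd, dotProduct, Fin.sum_univ_two]
    ring
  · ext i j
    simp [hY 0, one_apply, Pi.single_apply]

theorem isFundamentalMatrix (l : ℂ) :
    IsFundamentalMatrix (canonicalPotential p q) l (fundMat p q l) := by
  have hex : ∃ Y, IsFundamentalMatrix (canonicalPotential p q) l Y :=
    (h.exists_isMatrixSolution l).imp fun _ => isFundamentalMatrix_iff.2
  have hchoose : fundMat p q l = hex.choose := by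
    funext z
    simp only [fundMat, fundamentalMatrix, dif_pos hex]
  rw [hchoose]
  exact hex.choose_spec

theorem isMatrixSolution (l : ℂ) : IsMatrixSolution p q l (fundMat p q l) :=
  (isFundamentalMatrix_iff.1 (h.isFundamentalMatrix l)).1

theorem fundMat_zero (l : ℂ) : fundMat p q l 0 = 1 :=
  (h.isFundamentalMatrix l).init

theorem det_fundMat (l : ℂ) (z : ℝ) : (fundMat p q l z).det = 1 := by
  rw [(h.isMatrixSolution l).det_eq, h.fundMat_zero, det_one]

theorem eq_fundMat_mul (hY : IsMatrixSolution p q l Y) (z : ℝ) :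
    Y z = fundMat p q l z * Y 0 := by
  have hdet := h.det_fundMat l z
  have hwronskian i j := (h.isMatrixSolution l i).wronskian_eq (hY j) z
  simp only [h.fundMat_zero] at hwronskian
  rw [det_fin_two] at hdet
  rw [← Matrix.ext_iff, Fin.forall_fin_two]
  constructor <;> intro j <;> have h₀ := hwronskian 0 j <;> have h₁ := hwronskian 1 j <;>
    simp only [one_apply_eq, one_mul, ne_eq, one_ne_zero, zero_ne_one, not_false_eq_true,
      one_apply_ne, zero_mul, sub_zero, zero_sub, mul_apply, Fin.sum_univ_two] at h₀ h₁ ⊢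
  · linear_combination (-Y z 0 j) * hdet + fundMat p q l z 0 1 * h₀ - fundMat p q l z 0 0 * h₁
  · linear_combination (-Y z 1 j) * hdet + fundMat p q l z 1 1 * h₀ - fundMat p q l z 1 0 * h₁

theorem fundMat_add (l : ℂ) (t z : ℝ) :
    fundMat p q l (z + t) =
      fundMat (fun z => p (z + t)) (fun z => q (z + t)) l z * fundMat p q l t := by
  simpa only [zero_add] using (h.shift t).eq_fundMat_mul ((h.isMatrixSolution l).shift t) z

theorem fundMat_conj (l : ℂ) (z : ℝ) :
    fundMat p q (starRingEnd ℂ l) z = (fundMat p q l z).map (starRingEnd ℂ) := by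
  rw [h.eq_fundMat_mul (h.isMatrixSolution l).conj z, h.fundMat_zero,
    Matrix.map_one _ (map_zero _) (map_one _), mul_one]

end LocallyIntegrableEntries

end System

/-! ### High-energy asymptotics -/

section HighEnergy

open Complex Matrix

variable {p q : ℝ → ℝ} {l : ℂ} {u v : ℝ → ℂ} {z : ℝ}

/-- The complex coefficient `q + i p`, which couples the two amplitudes of a solution. -/
noncomputable def coupling (p q : ℝ → ℝ) (z : ℝ) : ℂ := q z + I * p z

/-- The coefficient of a solution along the eigenvector of `J` whose free solution is `e^{-ilz}`,
normalised by that exponential. -/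
noncomputable def dominantAmp (l : ℂ) (u v : ℝ → ℂ) (z : ℝ) : ℂ :=
  cexp (I * l * z) * (u z - I * v z)

/-- The coefficient of a solution along the eigenvector of `J` whose free solution is `e^{ilz}`,
with the same normalisation as `dominantAmp`. -/
noncomputable def recessiveAmp (l : ℂ) (u v : ℝ → ℂ) (z : ℝ) : ℂ :=
  cexp (I * l * z) * (u z + I * v z)

/-- The spectral projection of `J` for the eigenvalue `i`. -/
noncomputable def projPlus : Matrix (Fin 2) (Fin 2) ℂ :=
  !![1 / 2, -I / 2; I / 2, 1 / 2]

theorem isACPrimitive_cexp (c : ℂ) :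
    IsACPrimitive (fun z : ℝ => cexp (c * z)) (fun z => c * cexp (c * z)) := by
  have hderiv (z : ℝ) : HasDerivAt (fun z : ℝ => cexp (c * z)) (c * cexp (c * z)) z := by
    simpa [mul_comm] using ((hasDerivAt_id z).ofReal_comp.const_mul c).cexp
  exact (IsACPrimitive.of_contDiff (contDiff_const.mul ofRealCLM.contDiff).cexp).congr
    (Eventually.of_forall fun z => (hderiv z).deriv)

theorem norm_cexp_I_mul (c : ℂ) (z : ℝ) : ‖cexp (I * c * z)‖ = Real.exp (-(c.im * z)) := by
  simp [norm_exp]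

theorem tendsto_cexp_I_mul_im_atTop {c : ℝ} (hc : 0 < c) :
    Tendsto (fun l : ℂ => cexp (I * l * c)) (comap im atTop) (𝓝 0) := by
  rw [tendsto_zero_iff_norm_tendsto_zero]
  simp only [norm_cexp_I_mul]
  exact Real.tendsto_exp_neg_atTop_nhds_zero.comp (tendsto_comap.atTop_mul_const hc)

theorem norm_cexp_I_mul_le_one (hl : 0 ≤ l.im) (hz : 0 ≤ z) : ‖cexp (I * l * z)‖ ≤ 1 := by
  rw [norm_cexp_I_mul]
  exact Real.exp_le_one_iff.2 (neg_nonpos.2 (mul_nonneg hl hz))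

theorem tendsto_integral_mul_zero {ι : Type*} {L : Filter ι} [L.IsCountablyGenerated]
    {k : ℝ → ℂ} {F : ι → ℝ → ℂ} {C : ℝ} (hz : 0 ≤ z) (hk : IntervalIntegrable k volume 0 z)
    (hF : ∀ l, Continuous (F l)) (hbound : ∀ᶠ l in L, ∀ s ∈ Icc 0 z, ‖F l s‖ ≤ C)
    (hlim : ∀ s ∈ Ioo 0 z, Tendsto (fun l => F l s) L (𝓝 0)) :
    Tendsto (fun l => ∫ s in 0..z, k s * F l s) L (𝓝 0) := by
  have hzero : ∫ _ in 0..z, (0 : ℂ) = 0 := by simp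
  rw [← hzero]
  refine tendsto_integral_filter_of_dominated_convergence (fun s => ‖k s‖ * C) ?_ ?_
    (hk.norm.mul_const C) ?_
  · refine Eventually.of_forall fun l => ?_
    rw [uIoc_of_le hz]
    exact (hk.mul_continuousOn (hF l).continuousOn).1.aestronglyMeasurable
  · filter_upwards [hbound] with l hl
    refine Eventually.of_forall fun s hs => ?_
    rw [uIoc_of_le hz] at hs
    rw [norm_mul]
    exact mul_le_mul_of_nonneg_left (hl s (Ioc_subset_Icc_self hs)) (norm_nonneg _)
  · filter_upwards [compl_mem_ae_iff.2 (measure_singleton z)] with s hsz hs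
    rw [uIoc_of_le hz] at hs
    simpa using (hlim s ⟨hs.1, lt_of_le_of_ne hs.2 hsz⟩).const_mul (k s)

theorem LocallyIntegrableEntries.intervalIntegrable_coupling (h : LocallyIntegrableEntries p q)
    (a b : ℝ) : IntervalIntegrable (coupling p q) volume a b :=
  .add ⟨(h.right a b).1.ofReal, (h.right a b).2.ofReal⟩
    (.const_mul ⟨(h.left a b).1.ofReal, (h.left a b).2.ofReal⟩ I)

namespace IsSolution

variable (h : IsSolution p q l u v)
include h

theorem continuous_dominantAmp : Continuous (dominantAmp l u v) := by
  have := h.fst.continuous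
  have := h.snd.continuous
  unfold dominantAmp
  fun_prop

theorem continuous_recessiveAmp : Continuous (recessiveAmp l u v) := by
  have := h.fst.continuous
  have := h.snd.continuous
  unfold recessiveAmp
  fun_prop

theorem dominantAmp_eq (z : ℝ) :
    dominantAmp l u v z =
      dominantAmp l u v 0 + ∫ s in 0..z, coupling p q s * recessiveAmp l u v s := by
  have hprim : IsACPrimitive (dominantAmp l u v)
      fun z => coupling p q z * recessiveAmp l u v z := by
    refine ((isACPrimitive_cexp (I * l)).mul (h.fst.sub (h.snd.const_mul I))).congr
      (Eventually.of_forall fun z => ?_)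
    simp only [coupling, recessiveAmp]
    linear_combination (cexp (I * l * z) * (-l * v z - p z * v z)) * I_sq
  rw [hprim.integral_eq_sub, add_sub_cancel]

theorem recessiveAmp_eq (z : ℝ) :
    recessiveAmp l u v z = cexp (I * (2 * l) * z) * recessiveAmp l u v 0 +
      ∫ s in 0..z, starRingEnd ℂ (coupling p q s) *
        (cexp (I * (2 * l) * (z - s :)) * dominantAmp l u v s) := by
  have hprim : IsACPrimitive (fun z => cexp (-(I * l) * z) * (u z + I * v z))
      fun z => starRingEnd ℂ (coupling p q z) * (cexp (-(I * l) * z) * (u z - I * v z)) := by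
    refine ((isACPrimitive_cexp (-(I * l))).mul (h.fst.add (h.snd.const_mul I))).congr
      (Eventually.of_forall fun z => ?_)
    simp only [coupling, map_add, map_mul, conj_ofReal, conj_I]
    linear_combination (cexp (-(I * l) * z) * (-l * v z - p z * v z)) * I_sq
  have hintegrand (s : ℝ) : starRingEnd ℂ (coupling p q s) *
      (cexp (I * (2 * l) * (z - s :)) * dominantAmp l u v s) = cexp (I * (2 * l) * z) *
        (starRingEnd ℂ (coupling p q s) * (cexp (-(I * l) * s) * (u s - I * v s))) := by
    have hexp : cexp (I * (2 * l) * (z - s :)) * cexp (I * l * s) =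
        cexp (I * (2 * l) * z) * cexp (-(I * l) * s) := by
      rw [← Complex.exp_add, ← Complex.exp_add]
      push_cast
      ring_nf
    rw [dominantAmp]
    linear_combination (starRingEnd ℂ (coupling p q s) * (u s - I * v s)) * hexp
  have hexp : cexp (I * l * z) = cexp (I * (2 * l) * z) * cexp (-(I * l) * z) := by
    rw [← Complex.exp_add]
    ring_nf
  simp only [hintegrand]
  rw [intervalIntegral.integral_const_mul, hprim.integral_eq_sub, ← mul_add, recessiveAmp,
    recessiveAmp, hexp]
  simp [mul_assoc]

theorem norm_dominantAmp_add_norm_recessiveAmp_le (hpq : LocallyIntegrableEntries p q)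
    (hl : 0 ≤ l.im) (hz : 0 ≤ z) :
    ‖dominantAmp l u v z‖ + ‖recessiveAmp l u v z‖ ≤
      (‖u 0 - I * v 0‖ + ‖u 0 + I * v 0‖) * Real.exp (∫ s in 0..z, ‖coupling p q s‖) := by
  have hk a b : IntervalIntegrable (fun s => ‖coupling p q s‖) volume a b :=
    (hpq.intervalIntegrable_coupling a b).norm
  have hD := h.continuous_dominantAmp.norm
  have hR := h.continuous_recessiveAmp.norm
  refine le_mul_exp_of_le_integral (L := z)
    (u := fun z => ‖dominantAmp l u v z‖ + ‖recessiveAmp l u v z‖) (hD.add hR) hk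
    (fun x => norm_nonneg _) ?_ (right_mem_Icc.2 hz)
  rintro x ⟨hx, -⟩
  have hDx : ‖dominantAmp l u v x‖ ≤
      ‖u 0 - I * v 0‖ + ∫ s in 0..x, ‖coupling p q s‖ * ‖recessiveAmp l u v s‖ := by
    rw [h.dominantAmp_eq]
    exact norm_add_le_of_le (by simp [dominantAmp]) (norm_integral_le_of_norm_le hx
      (Eventually.of_forall fun s _ => (norm_mul _ _).le)
      ((hk 0 x).mul_continuousOn hR.continuousOn))
  have hRx : ‖recessiveAmp l u v x‖ ≤
      ‖u 0 + I * v 0‖ + ∫ s in 0..x, ‖coupling p q s‖ * ‖dominantAmp l u v s‖ := by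
    have h2l : 0 ≤ (2 * l).im := by simpa using hl
    rw [h.recessiveAmp_eq]
    refine norm_add_le_of_le ?_ (norm_integral_le_of_norm_le hx
      (Eventually.of_forall fun s hs => ?_) ((hk 0 x).mul_continuousOn hD.continuousOn))
    · simpa [recessiveAmp] using
        mul_le_of_le_one_left (norm_nonneg (u 0 + I * v 0)) (norm_cexp_I_mul_le_one h2l hx)
    · rw [norm_mul, norm_mul, norm_conj]
      gcongr
      exact mul_le_of_le_one_left (norm_nonneg _)
        (norm_cexp_I_mul_le_one h2l (sub_nonneg.2 hs.2))
  simp only [mul_add]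
  rw [integral_add ((hk 0 x).mul_continuousOn hD.continuousOn)
    ((hk 0 x).mul_continuousOn hR.continuousOn)]
  linarith

end IsSolution

namespace LocallyIntegrableEntries

section Limit

variable {U V : ℂ → ℝ → ℂ} {a b : ℂ} (h : LocallyIntegrableEntries p q)
  (hs : ∀ l, IsSolution p q l (U l) (V l)) (ha : ∀ l, U l 0 = a) (hb : ∀ l, V l 0 = b)
include h hs ha hb

theorem eventually_norm_amp_le (z : ℝ) :
    ∃ C, ∀ᶠ l in comap im atTop, ∀ s ∈ Icc 0 z,
      ‖dominantAmp l (U l) (V l) s‖ ≤ C ∧ ‖recessiveAmp l (U l) (V l) s‖ ≤ C := by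
  refine ⟨(‖a - I * b‖ + ‖a + I * b‖) * Real.exp (∫ s in 0..z, ‖coupling p q s‖), ?_⟩
  filter_upwards [tendsto_comap.eventually (eventually_ge_atTop (0 : ℝ))] with l hl s hsz
  have hsum := (hs l).norm_dominantAmp_add_norm_recessiveAmp_le h hl hsz.1
  rw [ha, hb] at hsum
  have hmono : ∫ t in 0..s, ‖coupling p q t‖ ≤ ∫ t in 0..z, ‖coupling p q t‖ :=
    integral_mono_interval le_rfl hsz.1 hsz.2 (Eventually.of_forall fun _ => norm_nonneg _)
      (h.intervalIntegrable_coupling 0 z).norm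
  have hsum' := hsum.trans (mul_le_mul_of_nonneg_left (Real.exp_le_exp.2 hmono) (by positivity))
  exact ⟨(le_add_of_nonneg_right (norm_nonneg _)).trans hsum',
    (le_add_of_nonneg_left (norm_nonneg _)).trans hsum'⟩

theorem tendsto_recessiveAmp (hz : 0 < z) :
    Tendsto (fun l => recessiveAmp l (U l) (V l) z) (comap im atTop) (𝓝 0) := by
  obtain ⟨C, hC⟩ := h.eventually_norm_amp_le hs ha hb z
  have hdecay {c : ℝ} (hc : 0 < c) :
      Tendsto (fun l : ℂ => cexp (I * (2 * l) * c)) (comap im atTop) (𝓝 0) := by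
    refine (tendsto_cexp_I_mul_im_atTop (mul_pos two_pos hc)).congr fun l => ?_
    push_cast
    ring_nf
  have hconj : IntervalIntegrable (fun s => starRingEnd ℂ (coupling p q s)) volume 0 z := by
    have := h.intervalIntegrable_coupling 0 z
    exact ⟨conjCLE.toContinuousLinearMap.integrable_comp this.1,
      conjCLE.toContinuousLinearMap.integrable_comp this.2⟩
  have hintegral : Tendsto (fun l => ∫ s in 0..z, starRingEnd ℂ (coupling p q s) *
      (cexp (I * (2 * l) * (z - s :)) * dominantAmp l (U l) (V l) s)) (comap im atTop) (𝓝 0) := by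
    refine tendsto_integral_mul_zero hz.le hconj (C := C)
      (fun l => .mul (by fun_prop) (hs l).continuous_dominantAmp) ?_ fun s hsz => ?_
    · filter_upwards [hC, tendsto_comap.eventually (eventually_ge_atTop (0 : ℝ))]
        with l hCl hl s hsz
      rw [norm_mul]
      exact (mul_le_of_le_one_left (norm_nonneg _) (norm_cexp_I_mul_le_one (by simpa using hl)
        (sub_nonneg.2 hsz.2))).trans (hCl s hsz).1
    · exact (hdecay (sub_pos.2 hsz.2)).zero_mul_isBoundedUnder_le
        (isBoundedUnder_of_eventually_le (a := C)
          (hC.mono fun l hl => (hl s (Ioo_subset_Icc_self hsz)).1))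
  have hR0 l : recessiveAmp l (U l) (V l) 0 = a + I * b := by simp [recessiveAmp, ha, hb]
  simpa only [(hs _).recessiveAmp_eq z, hR0, zero_mul, zero_add] using
    ((hdecay hz).mul_const (a + I * b)).add hintegral

theorem tendsto_dominantAmp (hz : 0 ≤ z) :
    Tendsto (fun l => dominantAmp l (U l) (V l) z) (comap im atTop) (𝓝 (a - I * b)) := by
  obtain ⟨C, hC⟩ := h.eventually_norm_amp_le hs ha hb z
  have hintegral := tendsto_integral_mul_zero hz (h.intervalIntegrable_coupling 0 z)
    (fun l => (hs l).continuous_recessiveAmp) (hC.mono fun l hl s hsz => (hl s hsz).2)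
    fun s hsz => h.tendsto_recessiveAmp hs ha hb hsz.1
  have hD0 l : dominantAmp l (U l) (V l) 0 = a - I * b := by simp [dominantAmp, ha, hb]
  simpa only [(hs _).dominantAmp_eq z, hD0, add_zero] using hintegral.const_add (a - I * b)

end Limit

variable (h : LocallyIntegrableEntries p q)
include h

theorem norm_fundMat_le (l : ℂ) (hz : 0 ≤ z) (i j : Fin 2) :
    ‖fundMat p q l z i j‖ ≤
      Real.exp (∫ s in 0..z, ‖coupling p q s‖) * Real.exp (|l.im| * z) := by
  wlog hl : 0 ≤ l.im generalizing l
  · have hconj := this (starRingEnd ℂ l) (by simpa using (not_le.1 hl).le)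
    rwa [h.fundMat_conj, Matrix.map_apply, norm_conj, conj_im, abs_neg] at hconj
  have hamp := (h.isMatrixSolution l j).norm_dominantAmp_add_norm_recessiveAmp_le h hl hz
  have hinit (j : Fin 2) : ‖fundMat p q l 0 0 j - I * fundMat p q l 0 1 j‖ +
      ‖fundMat p q l 0 0 j + I * fundMat p q l 0 1 j‖ = 2 := by
    rw [h.fundMat_zero]
    revert j
    norm_num [Fin.forall_fin_two]
  rw [hinit, dominantAmp, recessiveAmp, norm_mul, norm_mul, norm_cexp_I_mul, ← mul_add,
    Real.exp_neg, inv_mul_le_iff₀ (Real.exp_pos _)] at hamp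
  rw [abs_of_nonneg hl]
  set u := fundMat p q l z 0 j
  set v := fundMat p q l z 1 j
  have hu : ‖2 * u‖ ≤ ‖u - I * v‖ + ‖u + I * v‖ := by
    convert norm_add_le (u - I * v) (u + I * v) using 1
    ring_nf
  have hv : ‖2 * (I * v)‖ ≤ ‖u + I * v‖ + ‖u - I * v‖ := by
    convert norm_sub_le (u + I * v) (u - I * v) using 1
    ring_nf
  simp only [norm_mul, norm_ofNat, norm_I, one_mul] at hu hv
  revert i
  exact Fin.forall_fin_two.2 ⟨by linarith, by linarith⟩

theorem tendsto_fundMat (hz : 0 < z) (i j : Fin 2) :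
    Tendsto (fun l : ℂ => cexp (I * l * z) * fundMat p q l z i j) (comap im atTop)
      (𝓝 (projPlus i j)) := by
  let E : Matrix (Fin 2) (Fin 2) ℂ := 1
  have hinit (i : Fin 2) l : fundMat p q l 0 i j = E i j := by rw [h.fundMat_zero]
  have hproj (j : Fin 2) : projPlus 0 j = (E 0 j - I * E 1 j) / 2 ∧
      projPlus 1 j = I / 2 * (E 0 j - I * E 1 j) := by
    revert j
    simp [Fin.forall_fin_two, projPlus, E, neg_div]
    linear_combination (1 / 2 : ℂ) * I_sq
  have hD := h.tendsto_dominantAmp (fun l => h.isMatrixSolution l j) (hinit 0) (hinit 1) hz.le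
  have hR := h.tendsto_recessiveAmp (fun l => h.isMatrixSolution l j) (hinit 0) (hinit 1) hz
  simp only [dominantAmp, recessiveAmp] at hD hR
  revert i
  refine Fin.forall_fin_two.2 ⟨?_, ?_⟩
  · refine (((hD.add hR).div_const 2).congr fun l => by ring).trans (le_of_eq ?_)
    rw [(hproj j).1, add_zero]
  · refine (((hD.sub hR).const_mul (I / 2)).congr fun l => ?_).trans (le_of_eq ?_)
    · linear_combination (-cexp (I * l * z) * fundMat p q l z 1 j) * I_sq
    · rw [(hproj j).2, sub_zero]

end LocallyIntegrableEntries

end HighEnergy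

/-! ### Dependence on the spectral parameter -/

section SpectralParameter

open Matrix

variable {p q : ℝ → ℝ} {l : ℂ} {z : ℝ}

theorem J_mul_J : J * J = -1 := by
  simp [J, ← Matrix.ext_iff, Fin.forall_fin_two]

theorem mul_J_mul_transpose (A : Matrix (Fin 2) (Fin 2) ℂ) : A * J * Aᵀ = A.det • J := by
  simp only [J, ← Matrix.ext_iff, Fin.forall_fin_two, mul_apply, Fin.sum_univ_two, det_fin_two,
    transpose_apply, Matrix.smul_apply, smul_eq_mul, of_apply, cons_val', cons_val_zero,
    cons_val_one, cons_val_fin_one]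
  refine ⟨⟨?_, ?_⟩, ?_, ?_⟩ <;> ring

/-- The Gram matrix `∫₀ᶻ Y(s, l)ᵀ Y(s, m) ds` of the fundamental matrices `Y`. -/
noncomputable def gram (p q : ℝ → ℝ) (l m : ℂ) (z : ℝ) : Matrix (Fin 2) (Fin 2) ℂ :=
  of fun i j => ∫ s in 0..z, ((fundMat p q l s)ᵀ * fundMat p q m s) i j

namespace LocallyIntegrableEntries

variable (h : LocallyIntegrableEntries p q)
include h

theorem continuous_fundMat (l : ℂ) : Continuous (fundMat p q l) :=
  continuous_pi fun i => continuous_pi fun j => by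
    revert i
    exact Fin.forall_fin_two.2
      ⟨(h.isMatrixSolution l j).fst.continuous, (h.isMatrixSolution l j).snd.continuous⟩

theorem transpose_fundMat_mul_J_mul (l m : ℂ) (z : ℝ) :
    (fundMat p q l z)ᵀ * J * fundMat p q m z = J + (m - l) • gram p q l m z := by
  ext i j
  have hlagrange := ((h.isMatrixSolution l i).lagrange (h.isMatrixSolution m j)).integral_eq_sub 0 z
  rw [intervalIntegral.integral_const_mul, h.fundMat_zero, h.fundMat_zero] at hlagrange
  have hJ : (1 : Matrix (Fin 2) (Fin 2) ℂ) 0 i * (1 : Matrix (Fin 2) (Fin 2) ℂ) 1 j -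
      (1 : Matrix (Fin 2) (Fin 2) ℂ) 1 i * (1 : Matrix (Fin 2) (Fin 2) ℂ) 0 j = J i j := by
    revert i j
    simp [Fin.forall_fin_two, J]
  have hprod : ((fundMat p q l z)ᵀ * J * fundMat p q m z) i j =
      fundMat p q l z 0 i * fundMat p q m z 1 j - fundMat p q l z 1 i * fundMat p q m z 0 j := by
    simp [J, mul_apply, Fin.sum_univ_two]
    ring
  simp only [Matrix.add_apply, Matrix.smul_apply, smul_eq_mul, gram, of_apply, mul_apply,
    transpose_apply, Fin.sum_univ_two] at hprod ⊢
  rw [hprod, hlagrange, ← hJ]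
  ring

theorem fundMat_eq_sub_gram (l m : ℂ) (z : ℝ) :
    fundMat p q m z =
      fundMat p q l z - (m - l) • (fundMat p q l z * J * gram p q l m z) := by
  have hsymp : fundMat p q l z * J * (fundMat p q l z)ᵀ = J := by
    rw [mul_J_mul_transpose, h.det_fundMat, one_smul]
  calc fundMat p q m z = -(J * (J * fundMat p q m z)) := by
        rw [← mul_assoc, J_mul_J, neg_one_mul, neg_neg]
    _ = -(fundMat p q l z * J * ((fundMat p q l z)ᵀ * J * fundMat p q m z)) := by
        nth_rewrite 1 [← hsymp]
        simp only [mul_assoc]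
    _ = fundMat p q l z - (m - l) • (fundMat p q l z * J * gram p q l m z) := by
        rw [h.transpose_fundMat_mul_J_mul, mul_add, mul_assoc _ J J, J_mul_J, mul_smul_comm]
        simp [sub_eq_add_neg, add_comm]

theorem exists_norm_fundMat_le (l : ℂ) (z : ℝ) :
    ∃ B, ∀ m ∈ Metric.ball l 1, ∀ s ∈ Icc 0 z, ∀ i j, ‖fundMat p q m s i j‖ ≤ B := by
  refine ⟨Real.exp (∫ s in 0..z, ‖coupling p q s‖) * Real.exp ((|l.im| + 1) * z),
    fun m hm s hs i j => (h.norm_fundMat_le m hs.1 i j).trans ?_⟩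
  have him : |m.im| ≤ |l.im| + 1 := by
    have hsub : |m.im - l.im| ≤ 1 := by
      rw [← Complex.sub_im]
      exact (Complex.abs_im_le_norm _).trans (mem_ball_iff_norm.1 hm).le
    linarith [abs_sub_abs_le_abs_sub m.im l.im]
  have hcoupling : ∫ t in 0..s, ‖coupling p q t‖ ≤ ∫ t in 0..z, ‖coupling p q t‖ :=
    integral_mono_interval le_rfl hs.1 hs.2 (Eventually.of_forall fun _ => norm_nonneg _)
      (h.intervalIntegrable_coupling 0 z).norm
  have := hs.1
  gcongr
  exact hs.2

theorem exists_norm_transpose_mul_le (l : ℂ) (z : ℝ) :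
    ∃ C, ∀ m ∈ Metric.ball l 1, ∀ s ∈ Icc 0 z, ∀ i j,
      ‖((fundMat p q l s)ᵀ * fundMat p q m s) i j‖ ≤ C := by
  obtain ⟨B, hB⟩ := h.exists_norm_fundMat_le l z
  refine ⟨B * B + B * B, fun m hm s hs i j => ?_⟩
  have hBl := hB l (Metric.mem_ball_self one_pos) s hs
  have hBm := hB m hm s hs
  simp only [mul_apply, transpose_apply, Fin.sum_univ_two]
  exact norm_add_le_of_le (norm_mul_le_of_le (hBl _ _) (hBm _ _))
    (norm_mul_le_of_le (hBl _ _) (hBm _ _))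

theorem continuousAt_fundMat (l : ℂ) (hz : 0 ≤ z) : ContinuousAt (fun m => fundMat p q m z) l := by
  obtain ⟨C, hC⟩ := h.exists_norm_transpose_mul_le l z
  have hgram : ∀ᶠ m in 𝓝 l, ∀ i j, ‖gram p q l m z i j‖ ≤ C * |z - 0| := by
    filter_upwards [Metric.ball_mem_nhds l one_pos] with m hm i j
    refine norm_integral_le_of_norm_le_const fun s hs => ?_
    rw [uIoc_of_le hz] at hs
    exact hC m hm s (Ioc_subset_Icc_self hs) i j
  have hsub : Tendsto (fun m : ℂ => m - l) (𝓝 l) (𝓝 0) :=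
    tendsto_sub_nhds_zero_iff.2 tendsto_id
  have hzero : Tendsto (fun m => (m - l) • gram p q l m z) (𝓝 l) (𝓝 0) := by
    refine tendsto_pi_nhds.2 fun i => tendsto_pi_nhds.2 fun j => ?_
    exact hsub.zero_mul_isBoundedUnder_le
      (isBoundedUnder_of_eventually_le (hgram.mono fun m hm => hm i j))
  have hcont : Continuous fun A => fundMat p q l z - fundMat p q l z * J * A := by fun_prop
  have hlim := (hcont.tendsto 0).comp hzero
  rw [mul_zero, sub_zero] at hlim
  refine hlim.congr fun m => ?_
  rw [h.fundMat_eq_sub_gram l m z, Function.comp_apply, mul_smul_comm]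

theorem continuousAt_gram (l : ℂ) (hz : 0 ≤ z) : ContinuousAt (fun m => gram p q l m z) l := by
  obtain ⟨C, hC⟩ := h.exists_norm_transpose_mul_le l z
  refine tendsto_pi_nhds.2 fun i => tendsto_pi_nhds.2 fun j => ?_
  refine tendsto_integral_filter_of_dominated_convergence (fun _ => C) ?_ ?_
    intervalIntegrable_const ?_
  · refine Eventually.of_forall fun m => Continuous.aestronglyMeasurable ?_
    exact (((h.continuous_fundMat l).matrix_transpose).matrix_mul
      (h.continuous_fundMat m)).matrix_elem i j
  · filter_upwards [Metric.ball_mem_nhds l one_pos] with m hm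
    refine Eventually.of_forall fun s hs => ?_
    rw [uIoc_of_le hz] at hs
    exact hC m hm s (Ioc_subset_Icc_self hs) i j
  · refine Eventually.of_forall fun s hs => ?_
    rw [uIoc_of_le hz] at hs
    have hcont : Continuous fun A : Matrix (Fin 2) (Fin 2) ℂ => ((fundMat p q l s)ᵀ * A) i j :=
      (continuous_const.matrix_mul continuous_id).matrix_elem i j
    exact (hcont.tendsto _).comp (h.continuousAt_fundMat l hs.1.le)

theorem hasDerivAt_fundMat (l : ℂ) (hz : 0 ≤ z) (i j : Fin 2) :
    HasDerivAt (fun m => fundMat p q m z i j) (-(fundMat p q l z * J * gram p q l l z) i j) l := by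
  have hcont : Continuous fun A : Matrix (Fin 2) (Fin 2) ℂ => -(fundMat p q l z * J * A) i j :=
    ((continuous_const.matrix_mul continuous_id).matrix_elem i j).neg
  rw [hasDerivAt_iff_tendsto_slope]
  refine (((hcont.tendsto _).comp (h.continuousAt_gram l hz)).mono_left
    nhdsWithin_le_nhds).congr' ?_
  filter_upwards [self_mem_nhdsWithin] with m hm
  rw [slope_def_field, h.fundMat_eq_sub_gram l m z, Matrix.sub_apply, Matrix.smul_apply,
    smul_eq_mul, Function.comp_apply, sub_sub_cancel_left, neg_div,
    mul_div_cancel_left₀ _ (sub_ne_zero.2 hm)]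

theorem differentiable_fundMat (hz : 0 ≤ z) (i j : Fin 2) :
    Differentiable ℂ fun m => fundMat p q m z i j :=
  fun l => (h.hasDerivAt_fundMat l hz i j).differentiableAt

end LocallyIntegrableEntries

end SpectralParameter

/-! ### Lower bounds for the discriminant -/

section LowerBound

open Complex Matrix

theorem sum_norm_sq_le {N : Matrix (Fin 2) (Fin 2) ℂ} (hdet : N.det = 1) {B : ℝ}
    (hB : ∀ i j, ‖N i j‖ ≤ B) (w : Fin 2 → ℂ) :
    ∑ i, ‖w i‖ ^ 2 ≤ 4 * B ^ 2 * ∑ i, ‖(N *ᵥ w) i‖ ^ 2 := by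
  have hentry : ∀ c d x y : ℂ, ‖c‖ ≤ B → ‖d‖ ≤ B → ‖c * x - d * y‖ ^ 2 ≤
      2 * B ^ 2 * (‖x‖ ^ 2 + ‖y‖ ^ 2) := by
    intro c d x y hc hd
    have h : ‖c * x - d * y‖ ≤ B * ‖x‖ + B * ‖y‖ := by
      grw [norm_sub_le, norm_mul, norm_mul, hc, hd]
    grw [h]
    nlinarith [sq_nonneg (B * ‖x‖ - B * ‖y‖)]
  rw [det_fin_two] at hdet
  have h0 : w 0 = N 1 1 * (N *ᵥ w) 0 - N 0 1 * (N *ᵥ w) 1 := by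
    simp only [mulVec_eq_sum, Fin.sum_univ_two, Pi.add_apply, Pi.smul_apply, transpose_apply,
      op_smul_eq_smul, smul_eq_mul]
    linear_combination (-w 0) * hdet
  have h1 : w 1 = N 0 0 * (N *ᵥ w) 1 - N 1 0 * (N *ᵥ w) 0 := by
    simp only [mulVec_eq_sum, Fin.sum_univ_two, Pi.add_apply, Pi.smul_apply, transpose_apply,
      op_smul_eq_smul, smul_eq_mul]
    linear_combination (-w 1) * hdet
  simp only [Fin.sum_univ_two]
  have h0' := hentry _ _ ((N *ᵥ w) 0) ((N *ᵥ w) 1) (hB 1 1) (hB 0 1)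
  have h1' := hentry _ _ ((N *ᵥ w) 1) ((N *ᵥ w) 0) (hB 0 0) (hB 1 0)
  rw [← h0] at h0'
  rw [← h1] at h1'
  linarith

theorem le_norm_det {N : Matrix (Fin 2) (Fin 2) ℂ} {ρ : ℝ} (hρ : 0 ≤ ρ)
    (hN : ∀ w : Fin 2 → ℂ, ρ * ∑ i, ‖w i‖ ^ 2 ≤ ∑ i, ‖(N *ᵥ w) i‖ ^ 2) : ρ ≤ ‖N.det‖ := by
  -- testing with the columns of the adjugate bounds `ρ (∑ ‖N i j‖²)` by `2 ‖det N‖²`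
  have hcol0 : N *ᵥ ![N 1 1, -N 1 0] = ![N.det, 0] := by
    ext i; fin_cases i <;> simp [mulVec, dotProduct, det_fin_two] <;> ring
  have hcol1 : N *ᵥ ![-N 0 1, N 0 0] = ![0, N.det] := by
    ext i; fin_cases i <;> simp [mulVec, dotProduct, det_fin_two] <;> ring
  have h0 := hN ![N 1 1, -N 1 0]
  have h1 := hN ![-N 0 1, N 0 0]
  have he0 : ρ ≤ ‖N 0 0‖ ^ 2 + ‖N 1 0‖ ^ 2 := by
    simpa [mulVec, dotProduct] using hN ![1, 0]
  have he1 : ρ ≤ ‖N 0 1‖ ^ 2 + ‖N 1 1‖ ^ 2 := by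
    simpa [mulVec, dotProduct] using hN ![0, 1]
  rw [hcol0] at h0
  rw [hcol1] at h1
  simp only [Fin.sum_univ_two, cons_val_zero, cons_val_one, cons_val_fin_one, norm_neg, norm_zero,
    ne_eq, OfNat.ofNat_ne_zero, not_false_eq_true, zero_pow, add_zero, zero_add] at h0 h1
  refine le_of_sq_le_sq ?_ (norm_nonneg _)
  nlinarith [mul_le_mul_of_nonneg_left he0 hρ, mul_le_mul_of_nonneg_left he1 hρ]

theorem abs_eq_one_of_sq_eq_one {σ : ℝ} (hσ : σ ^ 2 = 1) : |σ| = 1 :=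
  abs_eq_abs.2 (sq_eq_sq_iff_eq_or_eq_neg.1 (hσ.trans (one_pow 2).symm)) |>.trans abs_one

theorem abs_im_conj_mul_sub_le {σ : ℝ} (hσ : σ ^ 2 = 1) (u v a b : ℂ) :
    |(starRingEnd ℂ u * v).im - (starRingEnd ℂ a * b).im| ≤
      ‖u + σ * a‖ * ‖v + σ * b‖ + (‖u + σ * a‖ * ‖b‖ + ‖a‖ * ‖v + σ * b‖) := by
  have hσ' : (σ : ℂ) ^ 2 = 1 := by exact_mod_cast hσ
  have hnorm : ‖(σ : ℂ)‖ = 1 := by rw [norm_real, Real.norm_eq_abs, abs_eq_one_of_sq_eq_one hσ]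
  have hdiff : starRingEnd ℂ u * v - starRingEnd ℂ a * b =
      starRingEnd ℂ (u + σ * a) * (v + σ * b) -
        σ * (starRingEnd ℂ (u + σ * a) * b + starRingEnd ℂ a * (v + σ * b)) := by
    simp only [map_add, map_mul, conj_ofReal]
    linear_combination (starRingEnd ℂ a * b) * hσ'
  rw [← sub_im, hdiff]
  grw [abs_im_le_norm, norm_sub_le, norm_mul (σ : ℂ), norm_add_le (starRingEnd ℂ _ * b)]
  simp only [norm_mul, norm_conj, hnorm, one_mul, le_refl]

theorem sq_div_one_add_mul_le {ω a b x y : ℝ} (hω : 0 ≤ ω)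
    (h : ω * (a ^ 2 + b ^ 2) ≤ x * y + (x * b + a * y)) :
    ω ^ 2 / (1 + ω) * (a ^ 2 + b ^ 2) ≤ x ^ 2 + y ^ 2 := by
  rw [div_mul_eq_mul_div, div_le_iff₀ (by positivity)]
  nlinarith [mul_le_mul_of_nonneg_left h hω, sq_nonneg (x - ω * b), sq_nonneg (y - ω * a),
    mul_nonneg hω (sq_nonneg (x - y))]

variable {p q : ℝ → ℝ} {l : ℂ} {L : ℝ} {σ : ℝ}

theorem IsMatrixSolution.mulVec {Y : ℝ → Matrix (Fin 2) (Fin 2) ℂ} (hY : IsMatrixSolution p q l Y)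
    (w : Fin 2 → ℂ) : IsSolution p q l (fun z => (Y z *ᵥ w) 0) (fun z => (Y z *ᵥ w) 1) := by
  simpa only [mulVec_eq_sum, Fin.sum_univ_two, Pi.add_apply, Pi.smul_apply, transpose_apply,
    op_smul_eq_smul, smul_eq_mul] using (hY 0).linear_comb (hY 1) (w 0) (w 1)

theorem IsSolution.mul_abs_im_le {u v : ℝ → ℂ} (h : IsSolution p q l u v) (hL : 0 ≤ L) {K : ℝ}
    (hK : ∀ s ∈ Icc 0 L, K ≤ ‖u s‖ ^ 2 + ‖v s‖ ^ 2) :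
    L * K * |l.im| ≤ |(starRingEnd ℂ (u L) * v L).im - (starRingEnd ℂ (u 0) * v 0).im| := by
  have hu := h.fst.continuous
  have hv := h.snd.continuous
  have hmono : L * K ≤ ∫ s in 0..L, (‖u s‖ ^ 2 + ‖v s‖ ^ 2) := by
    simpa using integral_mono_on (μ := volume) hL intervalIntegrable_const
      (Continuous.intervalIntegrable (by fun_prop) _ _) hK
  rw [← h.energy.integral_eq_sub 0 L, intervalIntegral.integral_const_mul, abs_mul,
    mul_comm |l.im|]
  gcongr
  exact hmono.trans (le_abs_self _)

namespace LocallyIntegrableEntries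

variable (h : LocallyIntegrableEntries p q)
include h

theorem det_fundMat_add_smul_one (hσ : σ ^ 2 = 1) (l : ℂ) (z : ℝ) :
    (fundMat p q l z + (σ : ℂ) • 1).det = σ * ((fundMat p q l z).trace + 2 * σ) := by
  have hσ' : (σ : ℂ) ^ 2 = 1 := by exact_mod_cast hσ
  have hdet := h.det_fundMat l z
  rw [det_fin_two] at hdet
  simp only [det_fin_two, trace_fin_two, Matrix.add_apply, Matrix.smul_apply, one_apply_eq,
    smul_eq_mul, mul_one, mul_zero, add_zero, one_apply_ne, ne_eq, zero_ne_one, one_ne_zero,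
    not_false_eq_true]
  linear_combination hdet - hσ'

theorem le_norm_trace_add (hL : 0 ≤ L) {B : ℝ} (hB0 : 0 < B)
    (hB : ∀ s ∈ Icc 0 L, ∀ i j, ‖fundMat p q l s i j‖ ≤ B) (hσ : σ ^ 2 = 1) {ω : ℝ}
    (hω : ω = L / (4 * B ^ 2) * |l.im|) :
    ω ^ 2 / (1 + ω) ≤ ‖(fundMat p q l L).trace + 2 * σ‖ := by
  have hω0 : 0 ≤ ω := hω ▸ by positivity
  have hdet : ‖(fundMat p q l L + (σ : ℂ) • 1).det‖ = ‖(fundMat p q l L).trace + 2 * σ‖ := by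
    rw [h.det_fundMat_add_smul_one hσ, norm_mul, norm_real, Real.norm_eq_abs,
      abs_eq_one_of_sq_eq_one hσ, one_mul]
  rw [← hdet]
  refine le_norm_det (by positivity) fun w => ?_
  have hlow : ∀ s ∈ Icc 0 L, (∑ i, ‖w i‖ ^ 2) / (4 * B ^ 2) ≤
      ‖(fundMat p q l s *ᵥ w) 0‖ ^ 2 + ‖(fundMat p q l s *ᵥ w) 1‖ ^ 2 := fun s hs => by
    rw [div_le_iff₀' (by positivity)]
    simpa only [Fin.sum_univ_two] using sum_norm_sq_le (h.det_fundMat l s) (hB s hs) w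
  have henergy := (((h.isMatrixSolution l).mulVec w).mul_abs_im_le hL hlow).trans
    (abs_im_conj_mul_sub_le hσ _ _ _ _)
  simp only [h.fundMat_zero, one_mulVec, Fin.sum_univ_two] at henergy
  have hle : ω * (‖w 0‖ ^ 2 + ‖w 1‖ ^ 2) ≤ _ := (le_of_eq (by rw [hω]; ring)).trans henergy
  simpa only [Fin.sum_univ_two, add_mulVec, smul_mulVec, one_mulVec, Pi.add_apply, Pi.smul_apply,
    smul_eq_mul] using sq_div_one_add_mul_le hω0 hle

theorem exists_mul_sq_im_le (hL : 0 < L) (hσ : σ ^ 2 = 1) {T : ℝ} (hT : 0 ≤ T) :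
    ∃ c > 0, ∀ l : ℂ, |l.im| ≤ T → c * l.im ^ 2 ≤ ‖(fundMat p q l L).trace + 2 * σ‖ := by
  set B := Real.exp (∫ s in 0..L, ‖coupling p q s‖) * Real.exp (T * L)
  have hB0 : 0 < B := by positivity
  set κ := L / (4 * B ^ 2)
  refine ⟨κ ^ 2 / (1 + κ * T), by positivity, fun l hl => ?_⟩
  have hbound : ∀ s ∈ Icc 0 L, ∀ i j, ‖fundMat p q l s i j‖ ≤ B := by
    intro s hs i j
    have hint : ∫ r in 0..s, ‖coupling p q r‖ ≤ ∫ r in 0..L, ‖coupling p q r‖ :=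
      integral_mono_interval le_rfl hs.1 hs.2 (Eventually.of_forall fun _ => norm_nonneg _)
        (h.intervalIntegrable_coupling 0 L).norm
    have hs0 : 0 ≤ s := hs.1
    grw [h.norm_fundMat_le l hs0 i j, hint, hl, hs.2]
  refine le_trans ?_ (h.le_norm_trace_add hL.le hB0 hbound hσ rfl)
  calc κ ^ 2 / (1 + κ * T) * l.im ^ 2 = (κ * |l.im|) ^ 2 / (1 + κ * T) := by
        rw [mul_pow, sq_abs]; ring
    _ ≤ (κ * |l.im|) ^ 2 / (1 + κ * |l.im|) := by gcongr

theorem im_eq_zero_of_trace (hL : 0 < L) (hσ : σ ^ 2 = 1)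
    (hl : (fundMat p q l L).trace + 2 * σ = 0) : l.im = 0 := by
  obtain ⟨c, hc, hle⟩ := h.exists_mul_sq_im_le hL hσ (abs_nonneg l.im)
  have hsq := hle l le_rfl
  rw [hl, norm_zero] at hsq
  exact pow_eq_zero_iff two_ne_zero |>.1 (by nlinarith [sq_nonneg l.im])

theorem tendsto_trace (hL : 0 < L) (c : ℂ) :
    Tendsto (fun l : ℂ => cexp (I * l * L) * ((fundMat p q l L).trace + c))
      (comap im atTop) (𝓝 1) := by
  have hlim := ((h.tendsto_fundMat hL 0 0).add (h.tendsto_fundMat hL 1 1)).add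
    ((tendsto_cexp_I_mul_im_atTop hL).mul_const c)
  have htrace : projPlus 0 0 + projPlus 1 1 + 0 * c = 1 := by
    simp [projPlus]; norm_num
  rw [htrace] at hlim
  exact hlim.congr fun l => by rw [trace_fin_two]; ring

theorem exists_exp_le_norm_trace (hL : 0 < L) (σ : ℝ) : ∃ T ≥ 0, ∀ l : ℂ, T ≤ |l.im| →
    Real.exp (|l.im| * L) ≤ 2 * ‖(fundMat p q l L).trace + 2 * σ‖ := by
  have hlim : ∀ᶠ l in comap im atTop,
      1 / 2 < ‖cexp (I * l * L) * ((fundMat p q l L).trace + 2 * σ)‖ :=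
    (h.tendsto_trace hL (2 * σ)).norm.eventually_const_lt (by norm_num)
  obtain ⟨T, -, hT⟩ := ((atTop_basis (α := ℝ)).comap im).eventually_iff.1 hlim
  have hupper : ∀ l : ℂ, T ≤ l.im →
      Real.exp (l.im * L) ≤ 2 * ‖(fundMat p q l L).trace + 2 * σ‖ := by
    intro l hl
    have hhalf := hT (show l ∈ im ⁻¹' Ici T from hl)
    rw [norm_mul, norm_cexp_I_mul, Real.exp_neg, inv_mul_eq_div,
      lt_div_iff₀ (Real.exp_pos _)] at hhalf
    linarith
  refine ⟨max T 0, le_max_right _ _, fun l hl => ?_⟩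
  have hTl := (le_max_left _ _).trans hl
  rcases le_total 0 l.im with hl0 | hl0
  · rw [abs_of_nonneg hl0] at hTl ⊢
    exact hupper l hTl
  · rw [abs_of_nonpos hl0] at hTl ⊢
    have hconj : (fundMat p q (starRingEnd ℂ l) L).trace + 2 * σ =
        starRingEnd ℂ ((fundMat p q l L).trace + 2 * σ) := by
      simp only [h.fundMat_conj, trace_fin_two, map_apply, map_add, map_mul, map_ofNat,
        conj_ofReal]
    have hle := hupper (starRingEnd ℂ l) (by simpa using hTl)
    rwa [hconj, norm_conj, conj_im] at hle

theorem exists_sq_im_mul_exp_le (hL : 0 < L) (hσ : σ ^ 2 = 1) : ∃ C, ∀ l : ℂ,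
    l.im ^ 2 * Real.exp (|l.im| * L) ≤
      C * (1 + l.im ^ 2) * ‖(fundMat p q l L).trace + 2 * σ‖ := by
  obtain ⟨T, hT0, hfar⟩ := h.exists_exp_le_norm_trace hL σ
  obtain ⟨c, hc, hstrip⟩ := h.exists_mul_sq_im_le hL hσ hT0
  refine ⟨2 + Real.exp (T * L) / c, fun l => ?_⟩
  set N := ‖(fundMat p q l L).trace + 2 * σ‖
  have hN : 0 ≤ N := norm_nonneg _
  rcases le_total T |l.im| with hl | hl
  · calc l.im ^ 2 * Real.exp (|l.im| * L) ≤ l.im ^ 2 * (2 * N) := by grw [hfar l hl]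
      _ ≤ 2 * (1 + l.im ^ 2) * N := by linarith
      _ ≤ (2 + Real.exp (T * L) / c) * (1 + l.im ^ 2) * N := by
        gcongr; exact le_add_of_nonneg_right (by positivity)
  · have hsq : l.im ^ 2 ≤ N / c := by rw [le_div_iff₀' hc]; exact hstrip l hl
    calc l.im ^ 2 * Real.exp (|l.im| * L) ≤ N / c * Real.exp (T * L) := by gcongr
      _ = Real.exp (T * L) / c * 1 * N := by ring
      _ ≤ (2 + Real.exp (T * L) / c) * (1 + l.im ^ 2) * N := by
        gcongr
        · linarith
        · linarith [sq_nonneg l.im]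

end LocallyIntegrableEntries

end LowerBound

section RealParameter

open Complex Matrix

theorem posDef_integral_transpose_mul_self {n : Type*} [Fintype n] [DecidableEq n]
    {A : ℝ → Matrix n n ℝ} (hA : Continuous A) (hdet : ∀ s, (A s).det ≠ 0) {L : ℝ} (hL : 0 < L) :
    (of fun i j => ∫ s in 0..L, ((A s)ᵀ * A s) i j).PosDef := by
  refine PosDef.of_dotProduct_mulVec_pos ?_ fun x hx => ?_
  · ext i j
    simp only [conjTranspose_apply, of_apply, star_trivial]
    exact integral_congr fun s _ => (isSymm_transpose_mul_self (A s)).apply i j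
  have hform : star x ⬝ᵥ (of fun i j => ∫ s in 0..L, ((A s)ᵀ * A s) i j) *ᵥ x =
      ∫ s in 0..L, (A s *ᵥ x) ⬝ᵥ (A s *ᵥ x) := by
    have hpt : ∀ s, (A s *ᵥ x) ⬝ᵥ (A s *ᵥ x) = ∑ i, ∑ j, x i * (((A s)ᵀ * A s) i j * x j) := by
      intro s
      rw [dotProduct_mulVec, vecMul_mulVec, ← dotProduct_mulVec]
      simp only [dotProduct, mulVec, Finset.mul_sum]
    have hcont : ∀ i j, Continuous fun s => x i * (((A s)ᵀ * A s) i j * x j) := fun i j =>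
      continuous_const.mul
        (((hA.matrix_transpose.matrix_mul hA).matrix_elem i j).mul continuous_const)
    simp_rw [hpt]
    rw [integral_finsetSum fun i _ =>
      (continuous_finsetSum _ fun j _ => hcont i j).intervalIntegrable _ _]
    simp only [dotProduct, mulVec, Finset.mul_sum, of_apply, star_trivial]
    refine Finset.sum_congr rfl fun i _ => ?_
    rw [integral_finsetSum fun j _ => (hcont i j).intervalIntegrable _ _]
    simp only [intervalIntegral.integral_const_mul, intervalIntegral.integral_mul_const]
  rw [hform]
  refine intervalIntegral_pos_of_pos (Continuous.intervalIntegrable ?_ _ _) (fun s => ?_) hL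
  · exact (hA.matrix_mulVec continuous_const).dotProduct (hA.matrix_mulVec continuous_const)
  · refine dotProduct_self_star_pos_iff.2 fun h0 => hx ?_
    exact eq_zero_of_mulVec_eq_zero (hdet s) h0

theorem eq_smul_one_of_trace_mul_eq_zero {A G : Matrix (Fin 2) (Fin 2) ℝ} (hdet : A.det = 1)
    (htr : A.trace ^ 2 ≤ 4) (hG : G.PosDef) (h : (A * !![0, 1; -1, 0] * G).trace = 0) :
    A = (A.trace / 2) • 1 := by
  have hsymm : G 1 0 = G 0 1 := by simpa using hG.isHermitian.apply 0 1
  have hG0 : 0 < G 0 0 := hG.diag_pos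
  have hG1 : 0 < G 1 1 := hG.diag_pos
  have hdetG : 0 < G 0 0 * G 1 1 - G 0 1 ^ 2 := by
    have := hG.det_pos
    rwa [det_fin_two, hsymm, ← sq] at this
  rw [det_fin_two] at hdet
  rw [trace_fin_two] at htr ⊢
  have horth : A 0 1 * G 0 0 + (A 1 1 - A 0 0) * G 0 1 - A 1 0 * G 1 1 = 0 := by
    rw [← neg_eq_zero, ← h]
    simp only [trace_fin_two, mul_apply, Fin.sum_univ_two, of_apply, cons_val', cons_val_zero,
      cons_val_one, cons_val_fin_one, hsymm]
    ring
  -- the symmetric part of `A J` has determinant `1 - (tr A)² / 4`, hence is semidefinite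
  have hsemidef : (A 1 1 - A 0 0) ^ 2 ≤ -4 * A 0 1 * A 1 0 := by linarith
  have hsum : (2 * A 0 1 * G 0 0 + (A 1 1 - A 0 0) * G 0 1) ^ 2 +
      (A 1 1 - A 0 0) ^ 2 * (G 0 0 * G 1 1 - G 0 1 ^ 2) ≤ 0 := by
    have hmul : 4 * A 0 1 * G 0 0 *
      (A 0 1 * G 0 0 + (A 1 1 - A 0 0) * G 0 1 - A 1 0 * G 1 1) = 0 := by rw [horth, mul_zero]
    linarith [mul_le_mul_of_nonneg_right hsemidef (mul_pos hG0 hG1).le]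
  have hdiag : A 1 1 - A 0 0 = 0 := by
    by_contra hne
    have := sq_nonneg (2 * A 0 1 * G 0 0 + (A 1 1 - A 0 0) * G 0 1)
    have := mul_pos (pow_pos (abs_pos.2 hne) 2) hdetG
    rw [sq_abs] at this
    linarith
  have h01 : A 0 1 = 0 := by
    rw [hdiag] at hsum
    have : 2 * A 0 1 * G 0 0 = 0 := by nlinarith [sq_nonneg (2 * A 0 1 * G 0 0)]
    simpa [hG0.ne'] using this
  have h10 : A 1 0 = 0 := by simpa [hdiag, h01, hG1.ne'] using horth
  ext i j
  revert i j
  simp [Fin.forall_fin_two, h01, h10, sub_eq_zero.1 hdiag]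

variable {p q : ℝ → ℝ}

namespace LocallyIntegrableEntries

variable (h : LocallyIntegrableEntries p q)
include h

theorem map_re_fundMat (x z : ℝ) : ((fundMat p q x z).map re).map ofReal = fundMat p q x z := by
  ext i j
  have hconj := congrFun (congrFun (h.fundMat_conj x z) i) j
  rw [conj_ofReal, map_apply] at hconj
  exact conj_eq_iff_re.1 hconj.symm

theorem det_map_re_fundMat (x z : ℝ) : ((fundMat p q x z).map re).det = 1 := by
  have hdet := h.det_fundMat x z
  rw [← h.map_re_fundMat x z] at hdet
  exact ofReal_injective ((ofRealHom.map_det _).trans (hdet.trans ofReal_one.symm))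

theorem exists_posDef_gram (x : ℝ) {L : ℝ} (hL : 0 < L) :
    ∃ G : Matrix (Fin 2) (Fin 2) ℝ, G.PosDef ∧ gram p q x x L = G.map ofReal := by
  refine ⟨_, posDef_integral_transpose_mul_self
    (A := fun s => (fundMat p q x s).map re) ((h.continuous_fundMat x).matrix_map continuous_re)
    (fun s => (h.det_map_re_fundMat x s).trans_ne one_ne_zero) hL, ?_⟩
  ext i j
  rw [gram, of_apply, map_apply, of_apply, ← intervalIntegral.integral_ofReal]
  refine integral_congr fun s _ => ?_
  rw [← h.map_re_fundMat x s]
  simp [mul_apply]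

theorem eq_smul_one_of_trace_mul_gram_eq_zero (x : ℝ) {L : ℝ} (hL : 0 < L)
    {M : Matrix (Fin 2) (Fin 2) ℂ} (hreal : (M.map re).map ofReal = M) (hdet : M.det = 1)
    (htr : M.trace.re ^ 2 ≤ 4) (h0 : (M * J * gram p q x x L).trace = 0) :
    M = (M.trace / 2) • 1 := by
  obtain ⟨G, hG, hgram⟩ := h.exists_posDef_gram x hL
  obtain ⟨A, rfl⟩ : ∃ A : Matrix (Fin 2) (Fin 2) ℝ, A.map ofReal = M := ⟨_, hreal⟩
  have htrace : (A.map ofReal).trace = A.trace := by simp [trace_fin_two]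
  have hscalar : A = (A.trace / 2) • (1 : Matrix (Fin 2) (Fin 2) ℝ) := by
    refine eq_smul_one_of_trace_mul_eq_zero
      (ofReal_injective ((ofRealHom.map_det A).trans (hdet.trans ofReal_one.symm)))
      (by rwa [htrace, ofReal_re] at htr) hG (ofReal_injective ?_)
    rw [hgram] at h0
    rw [ofReal_zero, ← h0]
    simp [J, trace_fin_two, mul_apply]
  ext i j
  rw [map_apply, congrFun (congrFun hscalar i) j, htrace]
  by_cases hij : i = j <;> simp [hij]

end LocallyIntegrableEntries

end RealParameter

/-! ### Quotients of entire functions -/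

section EntireQuotient

open Complex

theorem exists_local_quotient {F H : ℂ → ℂ} {z : ℂ} (hF : AnalyticAt ℂ F z) (hH : AnalyticAt ℂ H z)
    (hne : analyticOrderAt H z ≠ ⊤) (hle : analyticOrderAt H z ≤ analyticOrderAt F z) :
    ∃ φ : ℂ → ℂ, AnalyticAt ℂ φ z ∧ ∀ᶠ w in 𝓝 z, F w = φ w * H w := by
  obtain ⟨n, hn⟩ := ENat.ne_top_iff_exists.1 hne
  obtain ⟨H₁, hH₁, hH₁0, hH_eq⟩ := hH.analyticOrderAt_eq_natCast.1 hn.symm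
  obtain ⟨F₁, hF₁, hF_eq⟩ := (natCast_le_analyticOrderAt hF).1 (hn ▸ hle)
  refine ⟨fun w => F₁ w / H₁ w, hF₁.div hH₁ hH₁0, ?_⟩
  filter_upwards [hH_eq, hF_eq, hH₁.continuousAt.eventually_ne hH₁0] with w hHw hFw hH₁w
  rw [hHw, hFw, smul_eq_mul, smul_eq_mul]
  field_simp

theorem eventually_ne_zero_of_analyticOrderAt_ne_top {H : ℂ → ℂ} {z : ℂ} (hH : AnalyticAt ℂ H z)
    (hne : analyticOrderAt H z ≠ ⊤) : ∀ᶠ w in 𝓝[≠] z, H w ≠ 0 :=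
  hH.eventually_eq_zero_or_eventually_ne_zero.resolve_left fun h0 =>
    hne (analyticOrderAt_eq_top.2 h0)

theorem exists_entire_quotient {F H : ℂ → ℂ} (hF : Differentiable ℂ F) (hH : Differentiable ℂ H)
    (hne : ∀ z, analyticOrderAt H z ≠ ⊤) (hle : ∀ z, analyticOrderAt H z ≤ analyticOrderAt F z) :
    ∃ g : ℂ → ℂ, Differentiable ℂ g ∧ ∀ z, F z = g z * H z := by
  choose φ hφ_an hφ using fun z =>
    exists_local_quotient (hF.analyticAt z) (hH.analyticAt z) (hne z) (hle z)
  have hlocal : ∀ z, (fun w => φ w w) =ᶠ[𝓝 z] φ z := by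
    intro z
    filter_upwards [(hφ z).eventually_nhds, (hφ_an z).eventually_analyticAt] with w hw hw_an
    have hpunctured : φ w =ᶠ[𝓝[≠] w] φ z := by
      filter_upwards [eventually_ne_zero_of_analyticOrderAt_ne_top (hH.analyticAt w) (hne w),
        nhdsWithin_le_nhds (hφ w), nhdsWithin_le_nhds hw] with x hx hxw hxz
      exact mul_right_cancel₀ hx (hxw.symm.trans hxz)
    exact (((hφ_an w).continuousAt.eventuallyEq_nhds_iff_eventuallyEq_nhdsNE
      hw_an.continuousAt).1 hpunctured).eq_of_nhds
  exact ⟨fun w => φ w w, fun z => ((hφ_an z).congr (hlocal z).symm).differentiableAt,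
    fun z => (hφ z).self_of_nhds⟩

theorem norm_sq_sub_one_of_norm_eq_one {u : ℂ} (hu : ‖u‖ = 1) : ‖u ^ 2 - 1‖ = 2 * |u.im| := by
  have hconj : u * starRingEnd ℂ u = 1 := by
    rw [mul_conj, normSq_eq_norm_sq, hu, one_pow, ofReal_one]
  have hfactor : u ^ 2 - 1 = u * (u - starRingEnd ℂ u) := by rw [mul_sub, hconj, sq]
  rw [hfactor, norm_mul, hu, one_mul, sub_conj, norm_mul, norm_I, mul_one, norm_real,
    Real.norm_eq_abs, abs_mul, abs_two]

section Growth

variable {g : ℂ → ℂ} {C : ℝ} (hg : Differentiable ℂ g)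
  (hbound : ∀ z, ‖g z‖ * z.im ^ 2 ≤ C * (1 + z.im ^ 2))
include hg hbound

-- The factor vanishes to second order at `x ± 1`, where the circle meets the real axis.
theorem norm_sq_sub_one_sq_mul_le (x : ℝ) {w : ℂ} (hw : w ∈ Metric.ball (x : ℂ) 1) :
    ‖((w - x) ^ 2 - 1) ^ 2 * g w‖ ≤ 8 * C := by
  refine norm_le_of_forall_mem_frontier_norm_le (f := fun w => ((w - x) ^ 2 - 1) ^ 2 * g w)
    Metric.isBounded_ball (Differentiable.diffContOnCl (by fun_prop)) (fun s hs => ?_)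
    (subset_closure hw)
  rw [frontier_ball _ one_ne_zero, mem_sphere_iff_norm] at hs
  have him : (s - x).im = s.im := by rw [sub_im, ofReal_im, sub_zero]
  have him_le : s.im ^ 2 ≤ 1 := by
    rw [← sq_abs, sq_le_one_iff₀ (abs_nonneg _), ← him, ← hs]
    exact abs_im_le_norm _
  have hC : 0 ≤ C := by
    have hI := hbound I
    rw [I_im] at hI
    linarith [norm_nonneg (g I)]
  calc ‖((s - x) ^ 2 - 1) ^ 2 * g s‖ = 4 * (‖g s‖ * s.im ^ 2) := by
        rw [norm_mul, norm_pow, norm_sq_sub_one_of_norm_eq_one hs, him, mul_pow, sq_abs]; ring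
    _ ≤ 4 * (C * (1 + s.im ^ 2)) := by grw [hbound s]
    _ ≤ 8 * C := by nlinarith

theorem norm_le_of_norm_mul_sq_im_le (z : ℂ) : ‖g z‖ ≤ 16 * C := by
  have hg0 := norm_nonneg (g z)
  rcases le_total (1 / 2) |z.im| with hz | hz
  · have hz2 : 1 / 4 ≤ z.im ^ 2 := by rw [← sq_abs]; nlinarith
    by_contra! hlt
    nlinarith [hbound z, mul_le_mul_of_nonneg_right hlt.le (sq_nonneg z.im)]
  · have hdist : ‖z - z.re‖ = |z.im| := by
      have : z - z.re = z.im * I := by apply Complex.ext <;> simp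
      rw [this, norm_mul, norm_I, mul_one, norm_real, Real.norm_eq_abs]
    have hmax := norm_sq_sub_one_sq_mul_le hg hbound z.re (w := z) (by
      rw [mem_ball_iff_norm, hdist]; linarith)
    have hfactor : 3 / 4 ≤ ‖(z - z.re) ^ 2 - 1‖ := by
      have htri := norm_sub_norm_le (1 : ℂ) ((z - z.re) ^ 2)
      rw [norm_one, norm_pow, hdist, norm_sub_rev] at htri
      nlinarith [abs_nonneg z.im]
    have hprod : (3 / 4) ^ 2 * ‖g z‖ ≤ 8 * C := by
      rw [norm_mul, norm_pow] at hmax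
      grw [hfactor]
      exact hmax
    linarith

end Growth

instance : NeBot (comap im atTop) :=
  comap_neBot_iff_frequently.2 (Eventually.of_forall fun y => ⟨⟨0, y⟩, rfl⟩).frequently

theorem eq_mul_of_norm_mul_sq_im_le {F H : ℂ → ℂ} {C : ℝ} {c : ℂ} (hF : Differentiable ℂ F)
    (hH : Differentiable ℂ H) (hne : ∀ z, analyticOrderAt H z ≠ ⊤)
    (hle : ∀ z, analyticOrderAt H z ≤ analyticOrderAt F z)
    (hbound : ∀ z, ‖F z‖ * z.im ^ 2 ≤ C * (1 + z.im ^ 2) * ‖H z‖)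
    (hlim : Tendsto (fun z => F z / H z) (comap im atTop) (𝓝 c))
    (hH0 : ∀ᶠ z in comap im atTop, H z ≠ 0) (z : ℂ) : F z = c * H z := by
  obtain ⟨g, hg, hgF⟩ := exists_entire_quotient hF hH hne hle
  have hclosed : IsClosed {x : ℂ | ‖g x‖ * x.im ^ 2 ≤ C * (1 + x.im ^ 2)} := by
    have := hg.continuous
    have := continuous_im
    exact isClosed_le (by fun_prop) (by fun_prop)
  have hg_bound : ∀ z, ‖g z‖ * z.im ^ 2 ≤ C * (1 + z.im ^ 2) := by
    intro z
    have hpunctured : ∀ᶠ x in 𝓝[≠] z, ‖g x‖ * x.im ^ 2 ≤ C * (1 + x.im ^ 2) := by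
      filter_upwards [eventually_ne_zero_of_analyticOrderAt_ne_top (hH.analyticAt z) (hne z)]
        with x hx
      refine le_of_mul_le_mul_right ?_ (norm_pos_iff.2 hx)
      calc ‖g x‖ * x.im ^ 2 * ‖H x‖ = ‖F x‖ * x.im ^ 2 := by rw [hgF x, norm_mul]; ring
        _ ≤ C * (1 + x.im ^ 2) * ‖H x‖ := hbound x
    exact hclosed.mem_of_frequently_of_tendsto
      (hpunctured.frequently.filter_mono nhdsWithin_le_nhds) tendsto_id
  have hconst : ∀ w, g w = g z := fun w => hg.apply_eq_apply_of_bounded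
    (isBounded_iff_forall_norm_le.2 ⟨16 * C, forall_mem_range.2
      (norm_le_of_norm_mul_sq_im_le hg hg_bound)⟩) w z
  have hlim_const : Tendsto (fun _ : ℂ => g z) (comap im atTop) (𝓝 c) :=
    hlim.congr' (hH0.mono fun w hw => by rw [hgF w, hconst w, mul_div_cancel_right₀ _ hw])
  rw [hgF z, tendsto_nhds_unique tendsto_const_nhds hlim_const]

end EntireQuotient

/-! ### Comparison of adjacent half periods -/

section Comparison

open Complex Matrix

variable {p q : ℝ → ℝ} {l : ℂ} {σ : ℝ}

/-- The transition matrix of the system from `t` to `t + π / 2`. -/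
noncomputable def transition (p q : ℝ → ℝ) (t : ℝ) (l : ℂ) : Matrix (Fin 2) (Fin 2) ℂ :=
  fundMat (fun z => p (z + t)) (fun z => q (z + t)) l (Real.pi / 2)

/-- The comparison matrix `T(t + π/2)⁻¹ + σ T(t)` of the transition matrices `T` over two adjacent
half periods. It vanishes wherever the monodromy matrix is `-σ`. -/
noncomputable def comparison (p q : ℝ → ℝ) (σ t : ℝ) (l : ℂ) : Matrix (Fin 2) (Fin 2) ℂ :=
  (transition p q (t + Real.pi / 2) l).adjugate + (σ : ℂ) • transition p q t l

/-- The limit `projPlus.adjugate + σ • projPlus` of the normalized comparison matrix at high energy;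
it is `1` for `σ = 1` and `I • J` for `σ = -1`. -/
noncomputable def comparisonLimit (σ : ℝ) : Matrix (Fin 2) (Fin 2) ℂ :=
  !![(1 + σ) / 2, I * (1 - σ) / 2; -(I * (1 - σ) / 2), (1 + σ) / 2]

/-- A scalar combination of entries of the comparison matrix at `t = 0` whose normalized high-energy
limit is `1`. Multiplying by it matches the vanishing order and the growth of `Δ + 2 σ`. -/
noncomputable def comparisonPivot (p q : ℝ → ℝ) (σ : ℝ) (l : ℂ) : ℂ :=
  comparison p q σ 0 l 0 0 - I * comparison p q σ 0 l 0 1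

theorem adjugate_fin_two_apply {R : Type*} [CommRing R] (A : Matrix (Fin 2) (Fin 2) R)
    (i j : Fin 2) : A.adjugate i j = (-1) ^ (i + j : ℕ) * A j.rev i.rev := by
  revert i j
  simp [Fin.forall_fin_two, adjugate_fin_two]

theorem comparison_apply (p q : ℝ → ℝ) (σ t : ℝ) (l : ℂ) (i j : Fin 2) :
    comparison p q σ t l i j =
      (-1) ^ (i + j : ℕ) * transition p q (t + Real.pi / 2) l j.rev i.rev +
        σ * transition p q t l i j := by
  rw [comparison, Matrix.add_apply, Matrix.smul_apply, adjugate_fin_two_apply, smul_eq_mul]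

theorem comparisonLimit_apply (σ : ℝ) (i j : Fin 2) :
    comparisonLimit σ i j = (-1) ^ (i + j : ℕ) * projPlus j.rev i.rev + σ * projPlus i j := by
  revert i j
  simp only [Fin.forall_fin_two]
  refine ⟨⟨?_, ?_⟩, ?_, ?_⟩ <;> simp [comparisonLimit, projPlus] <;> ring

theorem comparisonLimit_pivot (σ : ℝ) : comparisonLimit σ 0 0 - I * comparisonLimit σ 0 1 = 1 := by
  simp only [comparisonLimit, of_apply, cons_val', cons_val_zero, cons_val_one, cons_val_fin_one]
  linear_combination ((σ : ℂ) / 2 - 1 / 2) * I_sq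

theorem det_comparisonLimit (σ : ℝ) : (comparisonLimit σ).det = σ := by
  simp only [comparisonLimit, det_fin_two_of]
  linear_combination ((1 - σ) / 2 : ℂ) ^ 2 * I_sq

namespace LocallyIntegrableEntries

variable (h : LocallyIntegrableEntries p q)
include h

theorem differentiable_comparison (σ t : ℝ) (i j : Fin 2) :
    Differentiable ℂ fun l => comparison p q σ t l i j := by
  simp only [comparison_apply]
  exact (((h.shift _).differentiable_fundMat Real.pi_div_two_pos.le _ _).const_mul _).add
    (((h.shift t).differentiable_fundMat Real.pi_div_two_pos.le i j).const_mul _)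

theorem differentiable_comparisonPivot (σ : ℝ) : Differentiable ℂ (comparisonPivot p q σ) :=
  (h.differentiable_comparison σ 0 0 0).sub ((h.differentiable_comparison σ 0 0 1).const_mul I)

theorem exists_norm_comparison_le (σ t : ℝ) (i j : Fin 2) :
    ∃ C ≥ 0, ∀ l : ℂ, ‖comparison p q σ t l i j‖ ≤ C * Real.exp (|l.im| * (Real.pi / 2)) := by
  have hT : ∀ t, ∃ C ≥ 0, ∀ l i j,
      ‖transition p q t l i j‖ ≤ C * Real.exp (|l.im| * (Real.pi / 2)) := fun t =>
    ⟨_, (Real.exp_pos _).le, fun l => (h.shift t).norm_fundMat_le l Real.pi_div_two_pos.le⟩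
  obtain ⟨C₁, hC₁, hle₁⟩ := hT (t + Real.pi / 2)
  obtain ⟨C₂, hC₂, hle₂⟩ := hT t
  refine ⟨C₁ + |σ| * C₂, by positivity, fun l => ?_⟩
  rw [comparison_apply]
  grw [norm_add_le, norm_mul, norm_mul, hle₁, hle₂]
  rw [norm_pow, norm_neg, norm_one, one_pow, norm_real, Real.norm_eq_abs]
  exact le_of_eq (by ring)

theorem exists_norm_comparisonPivot_le (σ : ℝ) :
    ∃ C ≥ 0, ∀ l : ℂ, ‖comparisonPivot p q σ l‖ ≤ C * Real.exp (|l.im| * (Real.pi / 2)) := by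
  obtain ⟨C₁, hC₁, hle₁⟩ := h.exists_norm_comparison_le σ 0 0 0
  obtain ⟨C₂, hC₂, hle₂⟩ := h.exists_norm_comparison_le σ 0 0 1
  refine ⟨C₁ + C₂, by positivity, fun l => ?_⟩
  rw [comparisonPivot]
  grw [norm_sub_le, norm_mul, hle₁, hle₂, norm_I]
  exact le_of_eq (by ring)

theorem tendsto_comparison (σ t : ℝ) (i j : Fin 2) :
    Tendsto (fun l : ℂ => cexp (I * l * (Real.pi / 2 : ℝ)) * comparison p q σ t l i j)
      (comap im atTop) (𝓝 (comparisonLimit σ i j)) := by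
  simp only [comparison_apply, comparisonLimit_apply]
  refine ((((h.shift (t + Real.pi / 2)).tendsto_fundMat Real.pi_div_two_pos _ _).const_mul _).add
    (((h.shift t).tendsto_fundMat Real.pi_div_two_pos i j).const_mul _)).congr fun l => ?_
  simp only [transition]
  ring

theorem tendsto_comparisonPivot (σ : ℝ) :
    Tendsto (fun l : ℂ => cexp (I * l * (Real.pi / 2 : ℝ)) * comparisonPivot p q σ l)
      (comap im atTop) (𝓝 1) := by
  rw [← comparisonLimit_pivot σ]
  refine ((h.tendsto_comparison σ 0 0 0).sub
    ((h.tendsto_comparison σ 0 0 1).const_mul I)).congr fun l => ?_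
  rw [comparisonPivot]
  ring

theorem fundMat_add_pi (hp : Function.Periodic p Real.pi) (hq : Function.Periodic q Real.pi)
    (l : ℂ) (t : ℝ) : fundMat p q l (t + Real.pi) = fundMat p q l t * fundMat p q l Real.pi := by
  simpa only [hp _, hq _] using h.fundMat_add l Real.pi t

theorem fundMat_add_half (l : ℂ) (t : ℝ) :
    fundMat p q l (t + Real.pi / 2) = transition p q t l * fundMat p q l t := by
  rw [add_comm, h.fundMat_add l t (Real.pi / 2), transition]

theorem comparison_mul (hp : Function.Periodic p Real.pi) (hq : Function.Periodic q Real.pi)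
    (σ : ℝ) (l : ℂ) (t : ℝ) :
    comparison p q σ t l * fundMat p q l t = fundMat p q l (t + Real.pi / 2) *
      ((fundMat p q l Real.pi).adjugate + (σ : ℂ) • 1) := by
  set T := transition p q (t + Real.pi / 2) l
  set Y := fundMat p q l
  have hT : T.adjugate * T = 1 := by
    have hdet : T.det = 1 := (h.shift (t + Real.pi / 2)).det_fundMat l _
    rw [adjugate_mul, hdet, one_smul]
  have hmonodromy : Y Real.pi * (Y Real.pi).adjugate = 1 := by
    rw [mul_adjugate, h.det_fundMat, one_smul]
  have hperiod : T * Y (t + Real.pi / 2) = Y t * Y Real.pi := by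
    rw [← h.fundMat_add_half, ← h.fundMat_add_pi hp hq, add_assoc, add_halves]
  have hadj : T.adjugate * Y t = Y (t + Real.pi / 2) * (Y Real.pi).adjugate :=
    calc T.adjugate * Y t = T.adjugate * (Y t * Y Real.pi) * (Y Real.pi).adjugate := by
          rw [mul_assoc, mul_assoc, hmonodromy, mul_one]
      _ = Y (t + Real.pi / 2) * (Y Real.pi).adjugate := by
          rw [← hperiod, ← mul_assoc T.adjugate, hT, one_mul]
  rw [comparison, add_mul, hadj, mul_add, Matrix.smul_mul, ← h.fundMat_add_half, Matrix.mul_smul,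
    mul_one]

theorem comparison_eq_zero (hp : Function.Periodic p Real.pi) (hq : Function.Periodic q Real.pi)
    (hM : fundMat p q l Real.pi = -(σ : ℂ) • 1) (t : ℝ) : comparison p q σ t l = 0 := by
  have hzero : comparison p q σ t l * fundMat p q l t = 0 := by
    rw [h.comparison_mul hp hq, hM, adjugate_smul, adjugate_one, Fintype.card_fin, pow_one,
      neg_smul, neg_add_cancel, mul_zero]
  calc comparison p q σ t l =
      comparison p q σ t l * fundMat p q l t * (fundMat p q l t).adjugate := by
        rw [mul_assoc, mul_adjugate, h.det_fundMat, one_smul, mul_one]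
    _ = 0 := by rw [hzero, zero_mul]

theorem hasDerivAt_trace_mul (R : Matrix (Fin 2) (Fin 2) ℂ) (l : ℂ) {z : ℝ} (hz : 0 ≤ z) :
    HasDerivAt (fun m => (R * fundMat p q m z).trace)
      (-(R * fundMat p q l z * J * gram p q l l z).trace) l := by
  have hentry := fun i j => h.hasDerivAt_fundMat l hz i j
  rw [mul_assoc, mul_assoc, ← mul_assoc (fundMat p q l z)]
  simp only [trace_fin_two, mul_apply (M := R), Fin.sum_univ_two]
  refine ((((hentry 0 0).const_mul (R 0 0)).add ((hentry 1 0).const_mul (R 0 1))).add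
    (((hentry 0 1).const_mul (R 1 0)).add ((hentry 1 1).const_mul (R 1 1)))).congr_deriv ?_
  ring

theorem hasDerivAt_trace_add (c l : ℂ) {z : ℝ} (hz : 0 ≤ z) :
    HasDerivAt (fun m => (fundMat p q m z).trace + c)
      (-(fundMat p q l z * J * gram p q l l z).trace) l := by
  simpa only [one_mul] using (h.hasDerivAt_trace_mul 1 l hz).add_const c

theorem differentiable_trace_add (c : ℂ) {z : ℝ} (hz : 0 ≤ z) :
    Differentiable ℂ fun l => (fundMat p q l z).trace + c :=
  fun l => (h.hasDerivAt_trace_add c l hz).differentiableAt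

theorem fundMat_pi_eq (hσ : σ ^ 2 = 1)
    (hdouble : HasOnlyDoubleZeros fun l => (fundMat p q l Real.pi).trace + 2 * σ)
    (hl : (fundMat p q l Real.pi).trace + 2 * σ = 0) : fundMat p q l Real.pi = -(σ : ℂ) • 1 := by
  obtain ⟨x, rfl⟩ : ∃ x : ℝ, (x : ℂ) = l :=
    ⟨l.re, Complex.ext rfl (h.im_eq_zero_of_trace Real.pi_pos hσ hl).symm⟩
  have hderiv : (fundMat p q x Real.pi * J * gram p q x x Real.pi).trace = 0 := by
    by_contra hne
    have horder :=
      ((h.differentiable_trace_add (2 * σ) Real.pi_pos.le).analyticAt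
        (x : ℂ)).analyticOrderAt_eq_one_of_zero_deriv_ne_zero hl (by
          rw [(h.hasDerivAt_trace_add _ _ Real.pi_pos.le).deriv]
          exact neg_ne_zero.2 hne)
    rw [hdouble _ hl] at horder
    exact absurd horder (by decide)
  have htrace : (fundMat p q x Real.pi).trace = -2 * σ := by linear_combination hl
  have hscalar := h.eq_smul_one_of_trace_mul_gram_eq_zero x Real.pi_pos
    (h.map_re_fundMat x Real.pi) (h.det_fundMat x Real.pi) (by
      rw [htrace, ← ofReal_ofNat, ← ofReal_neg, ← ofReal_mul, ofReal_re]
      linarith) hderiv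
  rwa [htrace, neg_mul, neg_div, mul_div_cancel_left₀ _ two_ne_zero] at hscalar

end LocallyIntegrableEntries

end Comparison

/-! ### Half-period symmetry from double zeros -/

section DoubleZeros

open Complex Matrix

variable {p q : ℝ → ℝ} {σ : ℝ}

namespace LocallyIntegrableEntries

variable (h : LocallyIntegrableEntries p q)
include h

theorem tendsto_comparison_mul_comparisonPivot_div (t : ℝ) (i j : Fin 2) :
    Tendsto (fun l : ℂ => comparison p q σ t l i j * comparisonPivot p q σ l /
      ((fundMat p q l Real.pi).trace + 2 * σ)) (comap im atTop) (𝓝 (comparisonLimit σ i j)) := by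
  have hlim := ((h.tendsto_comparison σ t i j).mul (h.tendsto_comparisonPivot σ)).div
    (h.tendsto_trace Real.pi_pos (2 * (σ : ℂ))) one_ne_zero
  rw [mul_one, div_one] at hlim
  refine hlim.congr fun l => ?_
  have hexp : cexp (I * l * Real.pi) =
      cexp (I * l * (Real.pi / 2 : ℝ)) * cexp (I * l * (Real.pi / 2 : ℝ)) := by
    rw [← Complex.exp_add, ← mul_add, ← ofReal_add, add_halves]
  rw [Pi.div_apply, hexp, mul_mul_mul_comm,
    mul_div_mul_left _ _ (mul_ne_zero (exp_ne_zero _) (exp_ne_zero _))]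

variable (hσ : σ ^ 2 = 1)
include hσ

theorem exists_norm_comparison_mul_comparisonPivot_le (t : ℝ) (i j : Fin 2) :
    ∃ C, ∀ l : ℂ, ‖comparison p q σ t l i j * comparisonPivot p q σ l‖ * l.im ^ 2 ≤
      C * (1 + l.im ^ 2) * ‖(fundMat p q l Real.pi).trace + 2 * σ‖ := by
  obtain ⟨C₁, hC₁, hcomparison⟩ := h.exists_norm_comparison_le σ t i j
  obtain ⟨C₂, hC₂, hpivot⟩ := h.exists_norm_comparisonPivot_le σ
  obtain ⟨C, htrace⟩ := h.exists_sq_im_mul_exp_le Real.pi_pos hσ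
  refine ⟨C₁ * C₂ * C, fun l => ?_⟩
  have hexp : Real.exp (|l.im| * (Real.pi / 2)) * Real.exp (|l.im| * (Real.pi / 2)) =
      Real.exp (|l.im| * Real.pi) := by
    rw [← Real.exp_add, ← mul_add, add_halves]
  calc ‖comparison p q σ t l i j * comparisonPivot p q σ l‖ * l.im ^ 2
      ≤ C₁ * Real.exp (|l.im| * (Real.pi / 2)) * (C₂ * Real.exp (|l.im| * (Real.pi / 2))) *
          l.im ^ 2 := by
        grw [norm_mul, hcomparison, hpivot]
    _ = C₁ * C₂ * (l.im ^ 2 * Real.exp (|l.im| * Real.pi)) := by rw [← hexp]; ring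
    _ ≤ C₁ * C₂ * (C * (1 + l.im ^ 2) * ‖(fundMat p q l Real.pi).trace + 2 * σ‖) := by
        grw [htrace]
    _ = C₁ * C₂ * C * (1 + l.im ^ 2) * ‖(fundMat p q l Real.pi).trace + 2 * σ‖ := by ring

variable (hp : Function.Periodic p Real.pi) (hq : Function.Periodic q Real.pi)
  (hdouble : HasOnlyDoubleZeros fun l => (fundMat p q l Real.pi).trace + 2 * σ)
include hp hq hdouble

theorem analyticOrderAt_trace_le (t : ℝ) (l : ℂ) (i j : Fin 2) :
    analyticOrderAt (fun l => (fundMat p q l Real.pi).trace + 2 * σ) l ≤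
      analyticOrderAt (fun l => comparison p q σ t l i j * comparisonPivot p q σ l) l := by
  by_cases hl : (fundMat p q l Real.pi).trace + 2 * σ = 0
  · have hzero := h.comparison_eq_zero hp hq (h.fundMat_pi_eq hσ hdouble hl)
    have hcomparison := (h.differentiable_comparison σ t i j).analyticAt l
    have hpivot := (h.differentiable_comparisonPivot σ).analyticAt l
    have hle : 1 ≤ analyticOrderAt (fun l => comparison p q σ t l i j) l := by
      rw [Order.one_le_iff_ne_zero, hcomparison.analyticOrderAt_ne_zero, hzero, Matrix.zero_apply]
    have hle' : 1 ≤ analyticOrderAt (comparisonPivot p q σ) l := by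
      rw [Order.one_le_iff_ne_zero, hpivot.analyticOrderAt_ne_zero, comparisonPivot, hzero,
        Matrix.zero_apply, Matrix.zero_apply, mul_zero, sub_zero]
    calc analyticOrderAt (fun l => (fundMat p q l Real.pi).trace + 2 * σ) l
        = 1 + 1 := by rw [hdouble l hl, one_add_one_eq_two]
      _ ≤ _ := add_le_add hle hle'
      _ = _ := (analyticOrderAt_mul hcomparison hpivot).symm
  · rw [((h.differentiable_trace_add (2 * σ) Real.pi_pos.le).analyticAt
      l).analyticOrderAt_eq_zero.2 hl]
    exact zero_le

theorem comparison_mul_comparisonPivot (t : ℝ) (l : ℂ) (i j : Fin 2) :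
    comparison p q σ t l i j * comparisonPivot p q σ l =
      comparisonLimit σ i j * ((fundMat p q l Real.pi).trace + 2 * σ) := by
  have htrace := h.differentiable_trace_add (2 * σ) Real.pi_pos.le
  obtain ⟨C, hC⟩ := h.exists_norm_comparison_mul_comparisonPivot_le hσ t i j
  refine eq_mul_of_norm_mul_sq_im_le
    ((h.differentiable_comparison σ t i j).mul (h.differentiable_comparisonPivot σ)) htrace
    (fun z => ?_) (h.analyticOrderAt_trace_le hσ hp hq hdouble t · i j) hC
    (h.tendsto_comparison_mul_comparisonPivot_div t i j) ?_ l
  · by_cases hz : (fundMat p q z Real.pi).trace + 2 * σ = 0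
    · rw [hdouble z hz]
      decide
    · rw [(htrace.analyticAt z).analyticOrderAt_eq_zero.2 hz]
      decide
  · exact ((h.tendsto_trace Real.pi_pos (2 * (σ : ℂ))).eventually_ne one_ne_zero).mono
      fun z => right_ne_zero_of_mul

theorem exists_comparison_eq_smul :
    ∃ κ : ℂ, κ ≠ 0 ∧ ∀ t, comparison p q σ t I = κ • comparisonLimit σ := by
  have htrace : (fundMat p q I Real.pi).trace + 2 * σ ≠ 0 := fun hzero =>
    one_ne_zero (I_im ▸ h.im_eq_zero_of_trace Real.pi_pos hσ hzero)
  have hmul := fun t => h.comparison_mul_comparisonPivot hσ hp hq hdouble t I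
  have hpivot : comparisonPivot p q σ I ≠ 0 := fun hzero => htrace <| by
    have h₀₀ := hmul 0 0 0
    have h₀₁ := hmul 0 0 1
    rw [hzero, mul_zero] at h₀₀ h₀₁
    linear_combination -((fundMat p q I Real.pi).trace + 2 * σ) * comparisonLimit_pivot σ -
      h₀₀ + I * h₀₁
  refine ⟨((fundMat p q I Real.pi).trace + 2 * σ) / comparisonPivot p q σ I,
    div_ne_zero htrace hpivot, fun t => ?_⟩
  ext i j
  rw [Matrix.smul_apply, smul_eq_mul, div_mul_eq_mul_div, eq_div_iff hpivot, hmul, mul_comm]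

theorem ae_eq_of_hasOnlyDoubleZeros :
    ∀ᵐ z, p (z + Real.pi / 2) = σ * p z ∧ q (z + Real.pi / 2) = σ * q z := by
  have hσ' : (σ : ℂ) ^ 2 = 1 := by exact_mod_cast hσ
  obtain ⟨κ, hκ, hcomparison⟩ := h.exists_comparison_eq_smul hσ hp hq hdouble
  set K := (fundMat p q I Real.pi).adjugate + (σ : ℂ) • 1
  have hgauge : ∀ z, fundMat p q I (z + Real.pi / 2) * (κ⁻¹ • K) =
      comparisonLimit σ * fundMat p q I z := fun z => by
    rw [Matrix.mul_smul, ← h.comparison_mul hp hq, hcomparison, Matrix.smul_mul,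
      inv_smul_smul₀ hκ]
  have hshift := ((h.isMatrixSolution I).shift (Real.pi / 2)).mul_const (κ⁻¹ • K)
  simp only [hgauge] at hshift
  have hrotate : IsMatrixSolution (fun z => σ * p z) (fun z => σ * q z) I
      fun z => comparisonLimit σ * fundMat p q I z :=
    (h.isMatrixSolution I).rotate (by linear_combination hσ' / 2)
      (by linear_combination -I / 2 * hσ')
  refine hshift.potential_ae_eq hrotate fun z => ?_
  rw [det_mul, det_comparisonLimit, h.det_fundMat, mul_one]
  rintro hzero
  simp [hzero] at hσ'

end LocallyIntegrableEntries

end DoubleZeros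

/-! ### Double zeros from half-period symmetry -/

section HalfPeriod

open Complex Matrix

variable {p q : ℝ → ℝ} {l : ℂ} {σ : ℝ}

/-- The constant matrix intertwining the systems with potentials `Q` and `σ Q`: it is `1` for
`σ = 1` and `J` for `σ = -1`. -/
noncomputable def gauge (σ : ℝ) : Matrix (Fin 2) (Fin 2) ℝ :=
  !![(1 + σ) / 2, (1 - σ) / 2; -((1 - σ) / 2), (1 + σ) / 2]

/-- The half-period map followed by the gauge; under half-period symmetry its square is `σ` times
the monodromy matrix. -/
noncomputable def halfMonodromy (p q : ℝ → ℝ) (σ : ℝ) (l : ℂ) : Matrix (Fin 2) (Fin 2) ℂ :=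
  (gauge σ).map ofReal * fundMat p q l (Real.pi / 2)

theorem map_gauge (σ : ℝ) : (gauge σ).map ofReal =
    !![(1 + σ : ℂ) / 2, (1 - σ) / 2; -((1 - σ) / 2), (1 + σ) / 2] := by
  ext i j
  fin_cases i <;> fin_cases j <;> simp [gauge]

theorem det_gauge (hσ : σ ^ 2 = 1) : (gauge σ).det = 1 := by
  rw [gauge, det_fin_two_of]
  linear_combination hσ / 2

theorem map_gauge_mul_self (hσ : σ ^ 2 = 1) :
    (gauge σ).map ofReal * (gauge σ).map ofReal = (σ : ℂ) • 1 := by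
  have hσ' : (σ : ℂ) ^ 2 = 1 := by exact_mod_cast hσ
  ext i j
  revert i j
  simp only [Fin.forall_fin_two, map_gauge, mul_apply, Fin.sum_univ_two, of_apply, cons_val',
    cons_val_zero, cons_val_one, cons_val_fin_one, Matrix.smul_apply, smul_eq_mul, one_apply,
    if_true, one_ne_zero, zero_ne_one, if_false]
  refine ⟨⟨?_, ?_⟩, ?_, ?_⟩
  · ring
  · linear_combination -hσ' / 2
  · linear_combination hσ' / 2
  · ring

theorem trace_mul_self_fin_two {R : Type*} [CommRing R] (A : Matrix (Fin 2) (Fin 2) R) :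
    (A * A).trace = A.trace ^ 2 - 2 * A.det := by
  rw [trace_fin_two, trace_fin_two, det_fin_two, mul_apply, mul_apply, Fin.sum_univ_two,
    Fin.sum_univ_two]
  ring

namespace LocallyIntegrableEntries

variable (h : LocallyIntegrableEntries p q)
include h

theorem hasDerivAt_trace_halfMonodromy (σ : ℝ) (l : ℂ) :
    HasDerivAt (fun m => (halfMonodromy p q σ m).trace)
      (-(halfMonodromy p q σ l * J * gram p q l l (Real.pi / 2)).trace) l :=
  h.hasDerivAt_trace_mul _ l Real.pi_div_two_pos.le

theorem map_re_halfMonodromy (σ x : ℝ) :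
    ((halfMonodromy p q σ x).map re).map ofReal = halfMonodromy p q σ x := by
  rw [halfMonodromy, ← h.map_re_fundMat x (Real.pi / 2)]
  ext i j
  simp [mul_apply]

variable (hσ : σ ^ 2 = 1)
include hσ

theorem det_halfMonodromy (l : ℂ) : (halfMonodromy p q σ l).det = 1 := by
  have hdet : ((gauge σ).map ofReal).det = 1 :=
    (ofRealHom.map_det (gauge σ)).symm.trans (congrArg ofReal (det_gauge hσ))
  rw [halfMonodromy, det_mul, hdet, h.det_fundMat, one_mul]

theorem trace_halfMonodromy_mul_gram_ne_zero {x : ℝ} (hx : (halfMonodromy p q σ x).trace = 0) :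
    (halfMonodromy p q σ x * J * gram p q x x (Real.pi / 2)).trace ≠ 0 := fun hzero => by
  have hscalar := h.eq_smul_one_of_trace_mul_gram_eq_zero x Real.pi_div_two_pos
    (h.map_re_halfMonodromy σ x) (h.det_halfMonodromy hσ x) (by rw [hx]; norm_num) hzero
  have hdet := h.det_halfMonodromy hσ x
  rw [hscalar, hx, zero_div, zero_smul, det_zero] at hdet
  exact zero_ne_one hdet

theorem analyticOrderAt_trace_halfMonodromy {x : ℝ} (hx : (halfMonodromy p q σ x).trace = 0) :
    analyticOrderAt (fun l => (halfMonodromy p q σ l).trace) x = 1 := by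
  have hderiv := h.hasDerivAt_trace_halfMonodromy σ
  have hdiff : Differentiable ℂ fun l => (halfMonodromy p q σ l).trace :=
    fun l => (hderiv l).differentiableAt
  refine (hdiff.analyticAt (x : ℂ)).analyticOrderAt_eq_one_of_zero_deriv_ne_zero hx ?_
  rw [(hderiv x).deriv]
  exact neg_ne_zero.2 (h.trace_halfMonodromy_mul_gram_ne_zero hσ hx)

variable (hsymm : ∀ᵐ z, p (z + Real.pi / 2) = σ * p z ∧ q (z + Real.pi / 2) = σ * q z)
include hsymm

theorem halfMonodromy_eq (l : ℂ) :
    halfMonodromy p q σ l = transition p q (Real.pi / 2) l * (gauge σ).map ofReal := by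
  have hσ' : (σ : ℂ) ^ 2 = 1 := by exact_mod_cast hσ
  have hgauge : IsMatrixSolution (fun z => p (z + Real.pi / 2)) (fun z => q (z + Real.pi / 2)) l
      fun z => (gauge σ).map ofReal * fundMat p q l z := by
    rw [map_gauge]
    exact ((h.isMatrixSolution l).rotate (by linear_combination hσ' / 2)
      (by linear_combination -hσ' / 2)).congr_potential (hsymm.mono fun z hz => hz.1.symm)
      (hsymm.mono fun z hz => hz.2.symm)
  rw [halfMonodromy, (h.shift _).eq_fundMat_mul hgauge, h.fundMat_zero, mul_one, transition]

theorem halfMonodromy_mul_self (l : ℂ) :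
    halfMonodromy p q σ l * halfMonodromy p q σ l = (σ : ℂ) • fundMat p q l Real.pi := by
  calc halfMonodromy p q σ l * halfMonodromy p q σ l
      = transition p q (Real.pi / 2) l * ((gauge σ).map ofReal * (gauge σ).map ofReal) *
          fundMat p q l (Real.pi / 2) := by
        nth_rw 1 [h.halfMonodromy_eq hσ hsymm]
        rw [halfMonodromy, mul_assoc, mul_assoc, mul_assoc]
    _ = (σ : ℂ) • fundMat p q l Real.pi := by
        rw [map_gauge_mul_self hσ, Matrix.mul_smul, mul_one, Matrix.smul_mul,
          ← h.fundMat_add_half, add_halves]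

theorem trace_fundMat_pi_add (l : ℂ) :
    (fundMat p q l Real.pi).trace + 2 * σ =
      σ * (halfMonodromy p q σ l).trace ^ 2 := by
  have hσ' : (σ : ℂ) ^ 2 = 1 := by exact_mod_cast hσ
  have hsq := trace_mul_self_fin_two (halfMonodromy p q σ l)
  rw [h.halfMonodromy_mul_self hσ hsymm, trace_smul, h.det_halfMonodromy hσ, smul_eq_mul] at hsq
  linear_combination σ * hsq - (fundMat p q l Real.pi).trace * hσ'

theorem hasOnlyDoubleZeros_of_ae_eq :
    HasOnlyDoubleZeros fun l => (fundMat p q l Real.pi).trace + 2 * σ := by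
  intro l hl
  have hσ0 : (σ : ℂ) ≠ 0 := ofReal_ne_zero.2 fun hzero => by simp [hzero] at hσ
  obtain ⟨x, rfl⟩ : ∃ x : ℝ, (x : ℂ) = l :=
    ⟨l.re, Complex.ext rfl (h.im_eq_zero_of_trace Real.pi_pos hσ hl).symm⟩
  have hx : (halfMonodromy p q σ x).trace = 0 := by
    have hl : (fundMat p q x Real.pi).trace + 2 * σ = 0 := hl
    rw [h.trace_fundMat_pi_add hσ hsymm] at hl
    exact pow_eq_zero_iff two_ne_zero |>.1 ((mul_eq_zero.1 hl).resolve_left hσ0)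
  have hanalytic : AnalyticAt ℂ (fun l => (halfMonodromy p q σ l).trace) x :=
    Differentiable.analyticAt (fun l => (h.hasDerivAt_trace_halfMonodromy σ l).differentiableAt) _
  have horder := h.analyticOrderAt_trace_halfMonodromy hσ hx
  simp only [h.trace_fundMat_pi_add hσ hsymm]
  refine (analyticOrderAt_mul analyticAt_const (hanalytic.pow 2)).trans ?_
  rw [analyticAt_const.analyticOrderAt_eq_zero.2 hσ0, analyticOrderAt_pow hanalytic, horder,
    zero_add, nsmul_one, Nat.cast_ofNat]

end LocallyIntegrableEntries

end HalfPeriod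

section Canonical

open Matrix

variable {p q : ℝ → ℝ} {σ : ℝ}

theorem eq_canonicalPotential {Q : ℝ → Matrix (Fin 2) (Fin 2) ℂ} (hherm : ∀ z, (Q z).IsHermitian)
    (hcan : IsCanonical Q) :
    Q = canonicalPotential (fun z => (Q z 0 0).re) fun z => (Q z 0 1).re := by
  funext z
  have hreal : ((Q z 0 0).re : ℂ) = Q z 0 0 := (hherm z).coe_re_apply_self 0
  have hentry := Matrix.ext_iff.2 (hcan z)
  simp only [Fin.forall_fin_two, antiPart, sigma1, sigma3, Matrix.add_apply, Matrix.smul_apply,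
    of_apply, cons_val', cons_val_zero, cons_val_one, cons_val_fin_one, smul_eq_mul, mul_zero,
    mul_one, zero_add, add_zero] at hentry
  obtain ⟨⟨h₀₀, h₀₁⟩, h₁₀, h₁₁⟩ := hentry
  rw [← Matrix.ext_iff]
  simp only [Fin.forall_fin_two, canonicalPotential, of_apply, cons_val', cons_val_zero,
    cons_val_one, cons_val_fin_one, hreal, true_and]
  exact ⟨h₀₁, h₁₀, by linear_combination h₀₀ + h₁₁⟩

theorem canonicalPotential_eq_smul_iff {z w : ℝ} :
    canonicalPotential p q w = (σ : ℂ) • canonicalPotential p q z ↔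
      p w = σ * p z ∧ q w = σ * q z := by
  rw [← Matrix.ext_iff]
  simp only [Fin.forall_fin_two, canonicalPotential, of_apply, cons_val', cons_val_zero,
    cons_val_one, cons_val_fin_one, Matrix.smul_apply, smul_eq_mul]
  norm_cast
  grind

theorem LocallyIntegrableEntries.of_periodic {T : ℝ} (hT : 0 < T) (hp : Function.Periodic p T)
    (hq : Function.Periodic q T) (hp_int : IntegrableOn p (Ico 0 T))
    (hq_int : IntegrableOn q (Ico 0 T)) : LocallyIntegrableEntries p q := by
  rw [← intervalIntegrable_iff_integrableOn_Ico_of_le hT.le] at hp_int hq_int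
  exact ⟨hp.intervalIntegrable₀ hT.ne' hp_int, hq.intervalIntegrable₀ hT.ne' hq_int⟩

theorem ae_shift_eq_smul_iff_hasOnlyDoubleZeros {Q : ℝ → Matrix (Fin 2) (Fin 2) ℂ}
    (hherm : ∀ z, (Q z).IsHermitian) (hcan : IsCanonical Q) (hper : Function.Periodic Q Real.pi)
    (hint : ∀ i j : Fin 2, IntegrableOn (fun z => Q z i j) (Ico 0 Real.pi)) (hσ : σ ^ 2 = 1) :
    (∀ᵐ z, Q (z + Real.pi / 2) = (σ : ℂ) • Q z) ↔
      HasOnlyDoubleZeros fun l => discriminant Q l + 2 * σ := by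
  have hp : Function.Periodic (fun z => (Q z 0 0).re) Real.pi := fun z => by simp only [hper z]
  have hq : Function.Periodic (fun z => (Q z 0 1).re) Real.pi := fun z => by simp only [hper z]
  have h := LocallyIntegrableEntries.of_periodic Real.pi_pos hp hq (hint 0 0).re (hint 0 1).re
  rw [eq_canonicalPotential hherm hcan]
  simp only [canonicalPotential_eq_smul_iff, discriminant]
  exact ⟨h.hasOnlyDoubleZeros_of_ae_eq hσ, h.ae_eq_of_hasOnlyDoubleZeros hσ hp hq⟩

end Canonical

end DiracSystem

theorem corollary5p3 (Q : ℝ → Matrix (Fin 2) (Fin 2) ℂ)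
    (hherm : ∀ z, (Q z).IsHermitian)
    (hcan : DiracSystem.IsCanonical Q)
    (hper : Function.Periodic Q Real.pi)
    (hint : ∀ i j : Fin 2, IntegrableOn (fun z => Q z i j) (Set.Ico 0 Real.pi)) :
    ((∀ᵐ z : ℝ, Q (z + Real.pi / 2) = Q z) ↔
      DiracSystem.HasOnlyDoubleZeros (fun lam => DiracSystem.discriminant Q lam + 2)) ∧
    ((∀ᵐ z : ℝ, Q (z + Real.pi / 2) = -Q z) ↔
      DiracSystem.HasOnlyDoubleZeros (fun lam => DiracSystem.discriminant Q lam - 2)) := by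
  have main {σ : ℝ} (hσ : σ ^ 2 = 1) :=
    DiracSystem.ae_shift_eq_smul_iff_hasOnlyDoubleZeros hherm hcan hper hint hσ
  constructor
  · simpa using main (σ := 1) (by norm_num)
  · simpa [sub_eq_add_neg] using main (σ := -1) (by norm_num)
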